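/- **Setting.** A hidden-action principal-agent problem has $n$ actions and $m$ outcomes. Each action $a$ has a distribution $F_a$ over the outcomes and a cost $c_a\in[0,1]$, each outcome $\omega$ has a reward $r_\omega\in[0,1]$, and some action has cost $0$. Under a contract $p\in\mathbb R_{\ge 0}^m$ the agent plays an action $a^\star(p)$ that maximizes $\sum_\omega F_{a,\omega}p_\omega-c_a$ and, among the maximizers, one that maximizes the principal's utility $\sum_\omega F_{a,\omega}(r_\omega-p_\omega)$; the map $p\mapsto a^\star(p)$ is fixed. Let $u(p)=\sum_\omega F_{a^\star(p),\omega}(r_\omega-p_\omega)$. In every round the principal commits to a contract $p$ and observes only an outcome, drawn from $F_{a^\star(p)}$ independently of the past given $p$. The principal knows $n$, $m$ and $r$, but neither the $F_a$ nor the $c_a$. **The algorithm Discover-and-Cover**, with inputs $\rho,\delta\in(0,1)$ and $B\ge 1$, uses $$\varepsilon=\frac{\rho^2}{32^2Bm^2n^2},\quad \eta=\frac{\varepsilon\sqrt m\,n}{2},\quad \alpha=\frac{\delta}{2n^3\left[\log\frac{2Bm}{\eta}+\binom{m+n+1}{m}\right]},\quad q=\left\lceil\frac{1}{2\varepsilon^2}\log\frac{2m}{\alpha}\right\rceil,$$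 $$y=18B\varepsilon mn^2+2n\eta\sqrt m,\qquad \gamma=27B\varepsilon mn^2+2n\eta\sqrt m,\qquad \mathcal P=\{p\in\mathbb R^m_{\ge0}:\|p\|_1\le mB\}.$$ It keeps a set $\mathcal D$ of meta-actions, and for each $d\in\mathcal D$ a set $\mathcal F[d]$ of empirical distributions and a representative $\widetilde F_d\in\mathcal F[d]$; initially $\mathcal D=\varnothing$. It runs Try-Cover again and again until Try-Cover succeeds, and then it runs Find-Contract. "Any" refers to an arbitrary rule that selects an element of each non-empty set. *Action-Oracle*$(p)$: commit to $p$ for $q$ rounds, let $\widetilde F$ be the empirical distribution of the outcomes, and let $\mathcal D^\diamond$ be the set of those $d\in\mathcal D$ for which some $F\in\mathcal F[d]$ has $\|F-\widetilde F\|_\infty\le2\varepsilon$. If $\mathcal D^\diamond=\{d\}$, add $\widetilde F$ to $\mathcal F[d]$ and return $d$. Otherwise replace the elements of $\mathcal D^\diamond$ by one new meta-action $d^\diamond$ with $\mathcal F[d^\diamond]=\{\widetilde F\}\cup\bigcup_{d\in\mathcal D^\diamond}\mathcal F[d]$ and $\widetilde F_{d^\diamond}=\widetilde F$, and return $\bot$.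 Whenever Action-Oracle returns $\bot$, the current run of Try-Cover ends without success. *Try-Cover*: put $\mathcal L_d=\varnothing$, $\mathcal U_d=\mathcal P$, $\mathcal D_d=\{d\}$ for all $d$, $\Delta\widetilde c_{ij}=0$ for all $i,j$, and $\mathcal C=\varnothing$. "Discovering" $d$ at $p$ means: if $\mathcal L_d=\varnothing$, put $\mathcal L_d=\{p\}$, call $p$ the seed of $d$, and add $d$ to $\mathcal C$. Call Action-Oracle at any $p\in\mathcal P$ and discover its answer at $p$. While $\mathcal C\neq\varnothing$, take any $i\in\mathcal C$, make passes as follows until $\mathcal U_i\subseteq\mathcal L_i$, and then remove $i$ from $\mathcal C$. A pass goes through the vertices $p$ of $\mathcal U_i$, in any order: let $j=$ Action-Oracle$(p)$ and discover $j$ at $p$; if $j\in\mathcal D_i$, replace $\mathcal L_i$ by the convex hull of $\mathcal L_i\cup\{p\}$; otherwise call Find-HS$(i,p)$ and end the pass. Try-Cover succeeds when $\mathcal C=\varnothing$. *Find-HS*$(i,p)$: let $p^1$ be the seed of $i$, let $p^2=p$, and then let $j=$ Action-Oracle$(p^1)$ and $k=$ Action-Oracle$(p^2)$. While $\|p^1-p^2\|_2>\eta$,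 let $p'=(p^1+p^2)/2$ and $d=$ Action-Oracle$(p')$, and discover $d$ at $p'$; if $d\in\mathcal D_i$ put $p^1=p'$ and $j=d$, otherwise put $p^2=p'$ and $k=d$. Finally, with $p'=(p^1+p^2)/2$, put $\Delta\widetilde c_{ik}=\sum_\omega(\widetilde F_{j,\omega}-\widetilde F_{k,\omega})p'_\omega$, increased by $\Delta\widetilde c_{ij}$ if $j\ne i$, intersect $\mathcal U_i$ with $\{p\in\mathbb R^m_{\ge0}:\sum_\omega(\widetilde F_{i,\omega}-\widetilde F_{k,\omega})p_\omega\ge\Delta\widetilde c_{ik}-y\}$, and add $k$ to $\mathcal D_i$. *Find-Contract*: choose $p^\star$ such that, for some $d^\star$, the pair $(d^\star,p^\star)$ maximizes $\sum_\omega\widetilde F_{d,\omega}(r_\omega-p_\omega)$ over all $d\in\mathcal D$ and $p\in\mathcal L_d\cap[0,B]^m$, and return $(1-\sqrt\gamma)\,p^\star+\sqrt\gamma\,r$. **Theorem.** There are a polynomial $\mathcal I$ in three variables and a $k\in\mathbb N$ such that, for all $\rho,\delta\in(0,1)$ and $B\ge1$, every instance with $n$ actions and $m$ outcomes, every such $a^\star$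 and every selection rule, with probability at least $1-\delta$ the Discover-and-Cover algorithm terminates after at most $$m^n\cdot\mathcal I(m,n,B)\cdot\frac1{\rho^4}\cdot\left(1+\log\frac1\delta\right)\cdot\left(1+\log\frac1\rho\right)^k$$ rounds (that is, $\widetilde{\mathcal O}(m^n\cdot\mathcal I\cdot\rho^{-4}\log(1/\delta))$ rounds) and returns a contract $p\in[0,B]^m$ with $u(p)\ge\max_{p'\in[0,B]^m}u(p')-\rho$, where the maximum exists. For constant $n$ the number of rounds is thus polynomial in $m$, $B$, $1/\rho$ and $\log(1/\delta)$. -/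

import Mathlib

open scoped BigOperators

noncomputable section

/-! ## Hidden-action principal-agent problems -/

/-- A payment scheme: a payment `p ω` for every outcome `ω`. -/
abbrev Contract (m : ℕ) : Type := Fin m → ℝ

/-- An instance of the hidden-action principal-agent problem with `n` actions and `m` outcomes. -/
structure PrincipalAgent (n m : ℕ) where
  /-- `F a ω` is the probability that action `a` results in outcome `ω`. -/
  F : Fin n → Fin m → ℝ
  /-- The cost of an action for the agent. -/
  c : Fin n → ℝ
  /-- The reward of an outcome for the principal. -/
  r : Fin m → ℝ
  F_nonneg : ∀ a ω, 0 ≤ F a ω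
  F_sum : ∀ a, ∑ ω, F a ω = 1
  c_mem : ∀ a, c a ∈ Set.Icc (0 : ℝ) 1
  r_mem : ∀ ω, r ω ∈ Set.Icc (0 : ℝ) 1
  exists_cost_zero : ∃ a, c a = 0

namespace PrincipalAgent

variable {n m : ℕ}

/-- The agent's expected utility for action `a` under contract `p`. -/
def agentUtility (P : PrincipalAgent n m) (p : Contract m) (a : Fin n) : ℝ :=
  ∑ ω, P.F a ω * p ω - P.c a

/-- The principal's expected utility when action `a` is played under contract `p`. -/
def principalUtility (P : PrincipalAgent n m) (p : Contract m) (a : Fin n) : ℝ :=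
  ∑ ω, P.F a ω * (P.r ω - p ω)

/-- The set of best responses of the agent to the contract `p`. -/
def bestResponses (P : PrincipalAgent n m) (p : Contract m) : Set (Fin n) :=
  {a | ∀ b, P.agentUtility p b ≤ P.agentUtility p a}

/-- `astar` describes the agent's behaviour: under every contract with non-negative payments, the
action played is a best response and, among the best responses, it is one that maximizes the
principal's expected utility. -/
def IsAgentResponse (P : PrincipalAgent n m) (astar : Contract m → Fin n) : Prop :=
  ∀ p : Contract m, (∀ ω, 0 ≤ p ω) →
    astar p ∈ P.bestResponses p ∧
      ∀ a ∈ P.bestResponses p, P.principalUtility p a ≤ P.principalUtility p (astar p)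

/-- The principal's expected utility `u p` when committing to `p`. -/
def u (P : PrincipalAgent n m) (astar : Contract m → Fin n) (p : Contract m) : ℝ :=
  P.principalUtility p (astar p)

/-- The law of the outcome generated by an action. -/
def outcomeLaw (P : PrincipalAgent n m) (a : Fin n) : PMF (Fin m) :=
  PMF.ofFintype (fun ω => ENNReal.ofReal (P.F a ω)) (by
    rw [← ENNReal.ofReal_sum_of_nonneg (fun ω _ => P.F_nonneg a ω), P.F_sum a, ENNReal.ofReal_one])

end PrincipalAgent

/-- The bounded contracts `[0, B] ^ m`. -/
def boundedContracts (m : ℕ) (B : ℝ) : Set (Contract m) :=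
  {p | ∀ ω, p ω ∈ Set.Icc 0 B}

/-- `p` lies in `[0, B] ^ m`, the maximum of `u` over `[0, B] ^ m` exists, and `p` attains it up
to `ρ`. -/
def PrincipalAgent.IsApproxOptimal {n m : ℕ} (P : PrincipalAgent n m) (astar : Contract m → Fin n)
    (B ρ : ℝ) (p : Contract m) : Prop :=
  p ∈ boundedContracts m B ∧
    ∃ M, IsGreatest (P.u astar '' boundedContracts m B) M ∧ M - ρ ≤ P.u astar p

/-! ## The repeated interaction -/

/-- What the principal does next: commit to a contract for one more round, or terminate and
return a contract. -/
inductive Move (m : ℕ) : Type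
  | commit (p : Contract m)
  | output (p : Contract m)

/-- A (deterministic) algorithm of the principal. The only feedback it receives is the outcome
realized in each round. -/
structure LearningAlgorithm (m : ℕ) where
  /-- The internal states of the algorithm. -/
  State : Type
  /-- The state before the first round. -/
  start : State
  /-- The next move in a given state. -/
  move : State → Move m
  /-- The state after the outcome of the round has been observed. -/
  observe : State → Fin m → State

/-- The law of the contract returned by the algorithm `A`, when it is continued from the state `s`
for at most `N` further rounds; the value `none` means that it has not terminated by then.
In every round in which the principal commits to `p`, the outcome is drawn from the distribution
of the action `astar p`, independently of the past given `p`. -/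
def PrincipalAgent.resultLaw {n m : ℕ} (P : PrincipalAgent n m) (astar : Contract m → Fin n)
    (A : LearningAlgorithm m) : ℕ → A.State → PMF (Option (Contract m))
  | 0, s =>
    match A.move s with
    | Move.output p => PMF.pure (some p)
    | Move.commit _ => PMF.pure none
  | N + 1, s =>
    match A.move s with
    | Move.output p => PMF.pure (some p)
    | Move.commit p =>
      (P.outcomeLaw (astar p)).bind fun ω => P.resultLaw astar A N (A.observe s ω)

/-! ## The `Discover-and-Cover` algorithm -/

namespace DiscoverAndCover

/-- How the algorithm resolves the instructions "take any ...": an arbitrary rule that selects an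
element of every non-empty set. -/
structure SelectionRule (m : ℕ) where
  contract : Set (Contract m) → Contract m
  contract_mem : ∀ S : Set (Contract m), S.Nonempty → contract S ∈ S
  metaAction : Finset ℕ → ℕ
  metaAction_mem : ∀ S : Finset ℕ, S.Nonempty → metaAction S ∈ S

/-- What the algorithm knows: the numbers `n` and `m` of actions and outcomes, the rewards of the
outcomes, and the inputs `B`, `ρ`, `δ`. The distributions and the costs of the actions are not
part of it. -/
structure Input (m : ℕ) where
  n : ℕ
  r : Fin m → ℝ
  B : ℝ
  ρ : ℝ
  δ : ℝ
  sel : SelectionRule m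

namespace Input

variable {m : ℕ} (X : Input m)

/-- The accuracy of the empirical distributions. -/
def ε : ℝ := X.ρ ^ 2 / (32 ^ 2 * X.B * (m : ℝ) ^ 2 * (X.n : ℝ) ^ 2)

/-- The accuracy of the binary search. -/
def η : ℝ := X.ε * √(m : ℝ) * X.n / 2

/-- The failure probability allowed to one call of `Action-Oracle`. -/
def α : ℝ :=
  X.δ / (2 * (X.n : ℝ) ^ 3 *
    (Real.log (2 * X.B * m / X.η) + ((m + X.n + 1).choose m : ℝ)))

/-- The number of rounds of one call of `Action-Oracle`. -/
def q : ℕ := ⌈1 / (2 * X.ε ^ 2) * Real.log (2 * m / X.α)⌉₊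

/-- The amount by which the approximate halfspaces are relaxed. -/
def y : ℝ := 18 * X.B * X.ε * m * (X.n : ℝ) ^ 2 + 2 * X.n * X.η * √(m : ℝ)

/-- The accuracy of the approximate best-response regions. -/
def γ : ℝ := 27 * X.B * X.ε * m * (X.n : ℝ) ^ 2 + 2 * X.n * X.η * √(m : ℝ)

/-- The set of contracts to be covered. -/
def region : Set (Contract m) := {p | (∀ ω, 0 ≤ p ω) ∧ ∑ ω, |p ω| ≤ m * X.B}

end Input

/-! ### `Action-Oracle` -/

/-- The meta-actions discovered so far (named by natural numbers) and the dictionary. -/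
structure Dictionary (m : ℕ) where
  /-- The current set of meta-actions. -/
  D : Finset ℕ
  /-- A name that has not been used yet. -/
  fresh : ℕ
  /-- The empirical distributions associated with a meta-action. -/
  F : ℕ → Set (Fin m → ℝ)
  /-- The empirical distribution that represents a meta-action. -/
  rep : ℕ → Fin m → ℝ

/-- Initially there are no meta-actions. -/
def Dictionary.empty (m : ℕ) : Dictionary m where
  D := ∅
  fresh := 0
  F := fun _ => ∅
  rep := fun _ _ => 0

open Classical in
/-- The meta-actions with a recorded distribution within `2 * ε` of `G`, in the sup norm. -/
def Dictionary.near {m : ℕ} (T : Dictionary m) (ε : ℝ) (G : Fin m → ℝ) : Finset ℕ :=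
  T.D.filter fun d => ∃ F ∈ T.F d, ‖F - G‖ ≤ 2 * ε

/-- The empirical distribution of a list of observed outcomes. -/
def empirical {m : ℕ} (l : List (Fin m)) : Fin m → ℝ :=
  fun ω => (l.count ω : ℝ) / (l.length : ℝ)

open Classical in
/-- Phase 2 of `Action-Oracle`: compare the empirical distribution `G` just computed with the
dictionary. If exactly one meta-action is close to `G`, then `G` is recorded there, and the
meta-action is returned. Otherwise all close meta-actions are merged into a new one, and `none`
(the value `⊥`) is returned. -/
def Dictionary.record {m : ℕ} (T : Dictionary m) (ε : ℝ) (G : Fin m → ℝ) :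
    Option ℕ × Dictionary m :=
  if h : ∃ d, T.near ε G = {d} then
    (some h.choose, { T with F := Function.update T.F h.choose (insert G (T.F h.choose)) })
  else
    (none,
      { D := insert T.fresh (T.D \ T.near ε G)
        fresh := T.fresh + 1
        F := fun d =>
          if d = T.fresh then insert G (⋃ e ∈ T.near ε G, T.F e)
          else if d ∈ T.near ε G then ∅
          else T.F d
        rep := Function.update T.rep T.fresh G })

/-! ### The variables and the control points of `Try-Cover` and `Find-HS` -/

/-- The variables of `Try-Cover`. -/
structure Cover (m : ℕ) where
  /-- The lower bounds. -/
  L : ℕ → Set (Contract m)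
  /-- The upper bounds. -/
  U : ℕ → Set (Contract m)
  /-- The contract with which a lower bound has been initialized. -/
  seed : ℕ → Contract m
  /-- `E i` contains `i` and the `k` for which the halfspace of the pair `i, k` has been found. -/
  E : ℕ → Finset ℕ
  /-- The estimates of the differences between the costs of two meta-actions. -/
  Δc : ℕ → ℕ → ℝ
  /-- The meta-actions that still have to be processed. -/
  C : Finset ℕ

/-- The points of the algorithm at which it waits for an answer of `Action-Oracle`. -/
inductive Phase (m : ℕ) : Type
  /-- `Try-Cover` has called it on its first contract. -/
  | first
  /-- `Try-Cover`, processing `i`, has called it on a vertex of the upper bound of `i`;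
  `V` consists of the vertices that remain in the current pass over the vertices. -/
  | vertex (i : ℕ) (V : Set (Contract m))
  /-- `Find-HS` with inputs `i` and `p` has called it on the seed of `i`. -/
  | left (i : ℕ) (p : Contract m)
  /-- `Find-HS` with input `i` has then called it on its second input; the first call was answered
  by `j`. -/
  | right (i j : ℕ)
  /-- `Find-HS` with input `i` has called it on the middle point of `p₁` and `p₂`. -/
  | middle (i : ℕ) (p₁ p₂ : Contract m) (j k : ℕ)
  /-- The algorithm has returned its contract. -/
  | halted

/-- The state between two calls of `Action-Oracle`: in a phase different from `halted`,
`point` is the contract on which `Action-Oracle` has been called, in the phase `halted` it is the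
contract returned by the algorithm. -/
structure Control (m : ℕ) where
  T : Dictionary m
  S : Cover m
  phase : Phase m
  point : Contract m

/-- The Euclidean distance of two contracts. -/
def dist₂ {m : ℕ} (p p' : Contract m) : ℝ := √(∑ ω, (p ω - p' ω) ^ 2)

/-- The middle point of two contracts. -/
def mid {m : ℕ} (p p' : Contract m) : Contract m := fun ω => (p ω + p' ω) / 2

namespace Input

variable {m : ℕ} (X : Input m)

/-- Start `Try-Cover` from scratch, with the current meta-actions. -/
def tryCover (T : Dictionary m) : Control m where
  T := T
  S :=
    { L := fun _ => ∅
      U := fun _ => X.region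
      seed := fun _ _ => 0
      E := fun d => {d}
      Δc := fun _ _ => 0
      C := ∅ }
  phase := Phase.first
  point := X.sel.contract X.region

/-- The estimate of the principal's utility under `p`, for the meta-action `d`. -/
def value (T : Dictionary m) (d : ℕ) (p : Contract m) : ℝ :=
  ∑ ω, T.rep d ω * (X.r ω - p ω)

/-- The contracts `p` in `[0, B] ^ m` that maximize the estimated utility over all the pairs of a
meta-action and of a contract of `[0, B] ^ m` in its lower bound. -/
def maximizers (T : Dictionary m) (S : Cover m) : Set (Contract m) :=
  {p | ∃ d ∈ T.D, p ∈ S.L d ∩ boundedContracts m X.B ∧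
    ∀ d' ∈ T.D, ∀ p' ∈ S.L d' ∩ boundedContracts m X.B, X.value T d' p' ≤ X.value T d p}

/-- `Find-Contract`: a maximizer of the estimated utility, moved towards the rewards. -/
def findContract (T : Dictionary m) (S : Cover m) : Control m where
  T := T
  S := S
  phase := Phase.halted
  point := fun ω => (1 - √X.γ) * X.sel.contract (X.maximizers T S) ω + √X.γ * X.r ω

/-- Continue a pass over the vertices of the upper bound of `i`, where `V` remains. -/
def nextVertex (T : Dictionary m) (S : Cover m) (i : ℕ) (V : Set (Contract m)) : Control m where
  T := T
  S := S
  phase := Phase.vertex i (V \ {X.sel.contract V})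
  point := X.sel.contract V

/-- Start a pass over the vertices of the upper bound of `i`. -/
def startPass (T : Dictionary m) (S : Cover m) (i : ℕ) : Control m :=
  X.nextVertex T S i ((S.U i).extremePoints ℝ)

open Classical in
/-- The meta-actions in `S.C` are processed one after the other; if there are none left,
`Try-Cover` has been successful, and `Find-Contract` is called. (A meta-action whose processing
has not begun has the whole region as its upper bound and a singleton as its lower bound, so that
there is at least one pass.) -/
def nextMetaAction (T : Dictionary m) (S : Cover m) : Control m :=
  if S.C.Nonempty then X.startPass T S (X.sel.metaAction S.C) else X.findContract T S

open Classical in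
/-- The end of a pass: process `i` further until its lower bound reaches its upper bound. -/
def endPass (T : Dictionary m) (S : Cover m) (i : ℕ) : Control m :=
  if S.U i ⊆ S.L i then X.nextMetaAction T { S with C := S.C.erase i } else X.startPass T S i

open Classical in
/-- If the lower bound of `d` is empty, initialize it by `p`, and add `d` to the meta-actions to be
processed. -/
def discover (S : Cover m) (d : ℕ) (p : Contract m) : Cover m :=
  if S.L d = ∅ then
    { S with
      L := Function.update S.L d {p}
      seed := Function.update S.seed d p
      C := insert d S.C }
  else S

/-- The end of `Find-HS`: estimate the difference of the costs of `i` and `k`, and intersect the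
upper bound of `i` with the approximate halfspace in which `i` is supposedly better than `k`. -/
def cut (T : Dictionary m) (S : Cover m) (i : ℕ) (p₁ p₂ : Contract m) (j k : ℕ) : Cover m :=
  let e : ℝ := ∑ ω, (T.rep j ω - T.rep k ω) * mid p₁ p₂ ω
  let Δ : ℝ := if j = i then e else S.Δc i j + e
  let H : Set (Contract m) :=
    {p | (∀ ω, 0 ≤ p ω) ∧ Δ - X.y ≤ ∑ ω, (T.rep i ω - T.rep k ω) * p ω}
  { S with
    Δc := Function.update S.Δc i (Function.update (S.Δc i) k Δ)
    U := Function.update S.U i (S.U i ∩ H)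
    E := Function.update S.E i (insert k (S.E i)) }

open Classical in
/-- The loop of `Find-HS`: go on with the binary search, or cut the upper bound of `i` and restart
the passes over its vertices. -/
def search (T : Dictionary m) (S : Cover m) (i : ℕ) (p₁ p₂ : Contract m) (j k : ℕ) : Control m :=
  if X.η < dist₂ p₁ p₂ then
    { T := T, S := S, phase := Phase.middle i p₁ p₂ j k, point := mid p₁ p₂ }
  else X.endPass T (X.cut T S i p₁ p₂ j k) i

open Classical in
/-- Continue after `Action-Oracle` has answered the call on the contract `p` by the meta-action
`d`. -/
def continueWith (T : Dictionary m) (S : Cover m) (phase : Phase m) (p : Contract m) (d : ℕ) :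
    Control m :=
  match phase with
  | Phase.first => X.nextMetaAction T (discover S d p)
  | Phase.vertex i V =>
    let S₁ := discover S d p
    if d ∈ S₁.E i then
      let S₂ : Cover m :=
        { S₁ with L := Function.update S₁.L i (convexHull ℝ (S₁.L i ∪ {p})) }
      if V.Nonempty then X.nextVertex T S₂ i V else X.endPass T S₂ i
    else { T := T, S := S₁, phase := Phase.left i p, point := S₁.seed i }
  | Phase.left i p₂ => { T := T, S := S, phase := Phase.right i d, point := p₂ }
  | Phase.right i j => X.search T S i (S.seed i) p j d
  | Phase.middle i p₁ p₂ j k =>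
    let S₁ := discover S d p
    if d ∈ S₁.E i then X.search T S₁ i p p₂ d k else X.search T S₁ i p₁ p j d
  | Phase.halted => { T := T, S := S, phase := Phase.halted, point := p }

/-- Continue after `Action-Oracle` has been called, where `G` is the empirical distribution that it
has computed. Whenever it returns `⊥`, the meta-actions have changed, and `Try-Cover` is started
again. -/
def answer (s : Control m) (G : Fin m → ℝ) : Control m :=
  match s.T.record X.ε G with
  | (none, T) => X.tryCover T
  | (some d, T) => X.continueWith T s.S s.phase s.point d

/-- The algorithm `Discover-and-Cover`. A state consists of the state of the control and of the
outcomes observed so far in the current call of `Action-Oracle`, which commits to the same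
contract for `q` consecutive rounds (its phase 1). -/
def algorithm : LearningAlgorithm m where
  State := Control m × List (Fin m)
  start := (X.tryCover (Dictionary.empty m), [])
  move := fun s =>
    match s.1.phase with
    | Phase.halted => Move.output s.1.point
    | _ => Move.commit s.1.point
  observe := fun s ω =>
    if s.2.length + 1 < X.q then (s.1, ω :: s.2)
    else (X.answer s.1 (empirical (ω :: s.2)), [])

end Input

end DiscoverAndCover

end

/-!
The proof separates what is random from what is not. Call the empirical distribution computed by a
call of `Action-Oracle` accurate if it is `ε`-close to the distribution of the action that has been
played. By Hoeffding's inequality a call is inaccurate with probability at most `α`. As long as all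
the calls are accurate, the run of the algorithm satisfies a deterministic invariant
(`RunInvariant`), from which both its correctness and a bound on the number of calls follow.

*The dictionary.* The meta-actions are the connected components of the set of the recorded
distributions, two of which are linked when they are `2 * ε`-close (`Consistent`). Hence every played
action belongs to a single meta-action, and two actions of one meta-action are joined by a chain of
at most `n - 1` steps of length `4 * ε`; as both of them are best responses somewhere, their costs are
close as well. Whenever `Action-Oracle` returns `⊥`, either an action is discovered or the number of
meta-actions drops, so that twice the number of discovered actions minus the number of meta-actions
increases (`Consistent.of_record_eq_none`). This bounds the number of the runs of `Try-Cover`.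

*The cover.* Within a run, each meta-action is represented by the action played under its seed.
A binary search ends at two contracts at distance at most `η`, between which the agent is almost
indifferent between the two actions that are played, and so it yields an estimate of the difference
of their costs. The errors add up along the at most `n - 1` cuts of an upper bound `U i`
(`CoverInvariant.cut`). Consequently `U i` contains all the contracts at which the representative
of `i` is the best representative (`CoverInvariant.mem_U`), and the representative of `i` is almost a
best response on the lower bound `L i` (`CoverInvariant.mem_nearBest`). So when `Try-Cover` succeeds,
the lower bounds cover the region by approximate best-response regions
(`CoverInvariant.exists_mem_L`).

*The returned contract.* Moving a contract by the fraction `√γ` towards the rewards changes the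
agent's utility for an action by `√γ` times the principal's utility. An action that is optimal for
the agent up to `O(γ)` can therefore be exchanged for an optimal one, in both directions, at the expense
of `O(√γ)` for the principal (`isApproxOptimal_findContract`).

*The number of calls.* An upper bound is a polytope with at most `m + n + 1` facets, hence with at most
`(m + n + 1).choose m` vertices (`extremePoints_polyhedron_finite`), and it is cut less often than
there are meta-actions. A run that starts with progress `s` works with at most `min s (2 * n - s)`
meta-actions; summing over the runs gives the number of calls that occurs in the definition of `α`
(`Setting.restartCalls_add_one_le`). The sum, rather than `2 * n` times the bound for `n`
meta-actions, is what makes this constant sufficient.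

*The probability.* Hoeffding's exponential moments form a supermartingale along the rounds of a call
(`deviationBound`), and an induction on the number of rounds combines it with the union bound over
the calls (`le_resultLaw`).
-/

noncomputable section

namespace DiscoverAndCover

/-! ### Polyhedra and their vertices -/

/-- A bounded polyhedron defined by finitely many linear inequalities has finitely many vertices: a
vertex is determined by `m` linearly independent inequalities that are tight at it. -/
theorem extremePoints_polyhedron_finite {m : ℕ} {ι : Type*} [Fintype ι] (α : ι → Fin m → ℝ)
    (β : ι → ℝ) (Q : Set (Fin m → ℝ)) (hQ : Q = {p | ∀ i, ∑ ω, α i ω * p ω ≤ β i}) :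
    (Q.extremePoints ℝ).Finite ∧ (Q.extremePoints ℝ).ncard ≤ (Fintype.card ι).choose m := by
  classical
  subst hQ
  set Q := {p : Fin m → ℝ | ∀ i, ∑ ω, α i ω * p ω ≤ β i} with hQdef
  have dot : ∀ f : (Fin m → ℝ) →ₗ[ℝ] ℝ, ∀ x, f x = ∑ ω, x ω * f (Pi.single ω 1) := by
    intro f x
    conv_lhs => rw [pi_eq_sum_univ' x]
    simp [map_sum]
  -- the tight constraints of a vertex span the dual space
  have span : ∀ x ∈ Q.extremePoints ℝ,
      Submodule.span ℝ (Set.range fun i : {i // ∑ ω, α i ω * x ω = β i} => α i) = ⊤ := by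
    intro x hx
    by_contra hne
    obtain ⟨f, hf0, hf⟩ := Submodule.exists_le_ker_of_lt_top _ (lt_top_iff_ne_top.2 hne)
    set v : Fin m → ℝ := fun ω => f (Pi.single ω 1) with hv
    have hv0 : v ≠ 0 := by
      intro h
      apply hf0
      ext x
      have := congrFun h x
      simpa [hv] using this
    have hxQ := hx.1
    -- a step along `v` that keeps the constraints that are not tight
    have step : ∃ s : ℝ, 0 < s ∧ ∀ i, |s * ∑ ω, α i ω * v ω| ≤ β i - ∑ ω, α i ω * x ω := by
      have h1 : ∀ i, ∀ᶠ s : ℝ in nhdsWithin 0 (Set.Ioi 0),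
          |s * ∑ ω, α i ω * v ω| ≤ β i - ∑ ω, α i ω * x ω := by
        intro i
        by_cases hi : ∑ ω, α i ω * x ω = β i
        · have h0 : ∑ ω, α i ω * v ω = 0 := by
            have := hf (Submodule.subset_span ⟨⟨i, hi⟩, rfl⟩)
            rw [LinearMap.mem_ker, dot] at this
            exact this
          filter_upwards with s
          simp [h0, hi]
        · have hlt : 0 < β i - ∑ ω, α i ω * x ω :=
            sub_pos.2 (lt_of_le_of_ne (hxQ i) hi)
          have hc : Continuous fun s : ℝ => |s * ∑ ω, α i ω * v ω| := by fun_prop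
          have ht := (hc.tendsto 0).mono_left (nhdsWithin_le_nhds (s := Set.Ioi 0))
          simp only [zero_mul, abs_zero] at ht
          exact (ht.eventually (gt_mem_nhds hlt)).mono fun s hs => hs.le
      obtain ⟨s, hs, hs0⟩ := ((Filter.eventually_all.2 h1).and self_mem_nhdsWithin).exists
      exact ⟨s, hs0, hs⟩
    obtain ⟨s, hs0, hs⟩ := step
    have sum_pm : ∀ i (t : ℝ), ∑ ω, α i ω * (x + t • v) ω
        = ∑ ω, α i ω * x ω + t * ∑ ω, α i ω * v ω := by
      intro i t
      rw [Finset.mul_sum, ← Finset.sum_add_distrib]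
      refine Finset.sum_congr rfl fun ω _ => ?_
      simp; ring
    have h1 : x + s • v ∈ Q := fun i => by
      rw [sum_pm]; have := (abs_le.1 (hs i)).2; linarith
    have h2 : x + (-s) • v ∈ Q := fun i => by
      rw [sum_pm]; have := (abs_le.1 (hs i)).1; linarith
    have h3 : x ∈ openSegment ℝ (x + s • v) (x + (-s) • v) :=
      ⟨1 / 2, 1 / 2, by norm_num, by norm_num, by norm_num, by ext ω; simp; ring⟩
    have := hx.2 h1 h2 h3
    have h4 : s • v = 0 := by simpa using this
    rcases smul_eq_zero.1 h4 with h | h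
    · exact hs0.ne' h
    · exact hv0 h
  have key : ∀ x ∈ Q.extremePoints ℝ, ∃ u : Finset ι, u.card = m ∧
      (∀ i ∈ u, ∑ ω, α i ω * x ω = β i) ∧
        Submodule.span ℝ (α '' (u : Set ι)) = ⊤ := by
    intro x hx
    obtain ⟨κ, a, ha, hsp, hli⟩ := exists_linearIndependent' ℝ
      (fun i : {i // ∑ ω, α i ω * x ω = β i} => α i)
    have : Finite κ := Finite.of_injective a ha
    have := Fintype.ofFinite κ
    rw [span x hx] at hsp
    have hcard : Fintype.card κ = m := by
      have := Module.finrank_eq_card_basis (Module.Basis.mk hli hsp.ge)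
      simpa using this.symm
    have hinj : Function.Injective fun k => (a k).1 := Subtype.val_injective.comp ha
    refine ⟨Finset.univ.image fun k => (a k).1, ?_, ?_, ?_⟩
    · rw [Finset.card_image_of_injective _ hinj, Finset.card_univ, hcard]
    · intro i hi
      obtain ⟨k, -, rfl⟩ := Finset.mem_image.1 hi
      exact (a k).2
    · rw [← hsp]
      congr 1
      ext z
      simp
  choose! u hu using key
  have hinj : Set.InjOn u (Q.extremePoints ℝ) := by
    intro x hx x' hx' h
    obtain ⟨-, h1, h2⟩ := hu x hx
    obtain ⟨-, h1', -⟩ := hu x' hx'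
    rw [← h] at h1'
    ext ω
    let g : (Fin m → ℝ) →ₗ[ℝ] ℝ := Fintype.linearCombination ℝ (x - x')
    have hg : ∀ z, g z = ∑ ω, z ω * (x ω - x' ω) := by
      intro z; simp [g, Fintype.linearCombination_apply]
    have hker : (⊤ : Submodule ℝ (Fin m → ℝ)) ≤ LinearMap.ker g := by
      rw [← h2, Submodule.span_le]
      rintro _ ⟨i, hi, rfl⟩
      have e1 := h1 i hi
      have e2 := h1' i hi
      simp only [SetLike.mem_coe, LinearMap.mem_ker, hg, mul_sub, Finset.sum_sub_distrib]
      rw [e1, e2, sub_self]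
    have := hker (x := Pi.single ω 1) trivial
    rw [LinearMap.mem_ker, hg] at this
    simp [Pi.single_apply] at this
    linarith
  have hmaps : Set.MapsTo u (Q.extremePoints ℝ)
      ((Finset.univ : Finset ι).powersetCard m : Set (Finset ι)) := by
    intro x hx
    simp [Finset.mem_powersetCard, (hu x hx).1]
  have hfin : (Q.extremePoints ℝ).Finite :=
    Set.Finite.of_injOn hmaps hinj (Finset.finite_toSet _)
  refine ⟨hfin, ?_⟩
  have := Set.ncard_le_ncard_of_injOn u hmaps hinj (Finset.finite_toSet _)
  rwa [Set.ncard_coe_finset, Finset.card_powersetCard, Finset.card_univ] at this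

/-! ### Concentration of the empirical distributions -/

/-- Hoeffding's lemma for a variable with values in `[0, 1]` on a finite probability space. -/
theorem sum_mul_exp_le {m : ℕ} (f : Fin m → ℝ) (hf : ∀ ω, 0 ≤ f ω) (hf1 : ∑ ω, f ω = 1)
    (Z : Fin m → ℝ) (hZ : ∀ ω, Z ω ∈ Set.Icc (0 : ℝ) 1) (t : ℝ) :
    ∑ ω, f ω * Real.exp (t * (Z ω - ∑ ω', f ω' * Z ω')) ≤ Real.exp (t ^ 2 / 8) := by
  let μ : PMF (Fin m) := PMF.ofFintype (fun ω => ENNReal.ofReal (f ω)) (by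
    rw [← ENNReal.ofReal_sum_of_nonneg (fun ω _ => hf ω), hf1, ENNReal.ofReal_one])
  have hint : ∀ g : Fin m → ℝ, ∫ ω, g ω ∂μ.toMeasure = ∑ ω, f ω * g ω := by
    intro g
    rw [PMF.integral_eq_sum]
    refine Finset.sum_congr rfl fun ω _ => ?_
    simp [μ, ENNReal.toReal_ofReal (hf ω)]
  have h := ProbabilityTheory.hasSubgaussianMGF_of_mem_Icc (μ := μ.toMeasure) (X := Z) (a := 0)
    (b := 1) (measurable_of_finite _).aemeasurable (Filter.Eventually.of_forall hZ)
  have h2 := h.mgf_le t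
  rw [ProbabilityTheory.mgf, hint, hint] at h2
  refine h2.trans (le_of_eq ?_)
  congr 1
  simp
  ring

/-- An upper bound on the probability that `q` draws from `f` lead to an empirical distribution that
is not `ε`-close to `f`, given the draws in `l`: the sum over the outcomes of the two exponential
moments of Hoeffding's inequality. -/
def deviationBound {m : ℕ} (q : ℕ) (ε : ℝ) (f : Fin m → ℝ) (l : List (Fin m)) : ℝ :=
  ∑ ω, ∑ t ∈ ({4 * ε, -(4 * ε)} : Finset ℝ),
    Real.exp (t * ((l.count ω : ℝ) - l.length * f ω) + ((q : ℝ) - l.length) * (t ^ 2 / 8)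
      - 4 * ε * (q * ε))

theorem deviationBound_nonneg {m : ℕ} (q : ℕ) (ε : ℝ) (f : Fin m → ℝ) (l : List (Fin m)) :
    0 ≤ deviationBound q ε f l :=
  Finset.sum_nonneg fun _ _ => Finset.sum_nonneg fun _ _ => (Real.exp_pos _).le

/-- `deviationBound` is a supermartingale. -/
theorem sum_deviationBound_cons_le {m : ℕ} (q : ℕ) (ε : ℝ) (f : Fin m → ℝ) (hf : ∀ ω, 0 ≤ f ω)
    (hf1 : ∑ ω, f ω = 1) (l : List (Fin m)) :
    ∑ ω, f ω * deviationBound q ε f (ω :: l) ≤ deviationBound q ε f l := by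
  classical
  unfold deviationBound
  simp_rw [Finset.mul_sum]
  rw [Finset.sum_comm]
  refine Finset.sum_le_sum fun ω _ => ?_
  rw [Finset.sum_comm]
  refine Finset.sum_le_sum fun t _ => ?_
  have hH := sum_mul_exp_le f hf hf1 (fun ω' => if ω' = ω then 1 else 0)
    (fun ω' => by split_ifs <;> simp) t
  have hmean : ∑ ω', f ω' * (if ω' = ω then (1 : ℝ) else 0) = f ω := by simp
  rw [hmean] at hH
  set A := Real.exp (t * ((l.count ω : ℝ) - l.length * f ω)
    + ((q : ℝ) - l.length - 1) * (t ^ 2 / 8) - 4 * ε * (q * ε)) with hA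
  have e1 : ∀ ω', f ω' * Real.exp (t * (((ω' :: l).count ω : ℝ) - (ω' :: l).length * f ω)
      + ((q : ℝ) - (ω' :: l).length) * (t ^ 2 / 8) - 4 * ε * (q * ε))
      = A * (f ω' * Real.exp (t * ((if ω' = ω then 1 else 0) - f ω))) := by
    intro ω'
    rw [hA, mul_left_comm (Real.exp _), ← Real.exp_add]
    congr 2
    rw [List.count_cons, List.length_cons]
    by_cases h : ω' = ω
    · simp [h]; ring
    · simp [h]; ring
  simp_rw [e1]
  rw [← Finset.mul_sum]
  refine (mul_le_mul_of_nonneg_left hH (Real.exp_pos _).le).trans (le_of_eq ?_)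
  rw [← Real.exp_add]
  congr 1
  ring

/-- After `q` draws, `deviationBound` is at least `1` if the empirical distribution is not
`ε`-close. -/
theorem one_le_deviationBound {m : ℕ} {q : ℕ} (hq : 0 < q) {ε : ℝ} (hε : 0 < ε) (f : Fin m → ℝ)
    (l : List (Fin m)) (hl : l.length = q) (h : ¬ ‖empirical l - f‖ ≤ ε) :
    1 ≤ deviationBound q ε f l := by
  rw [pi_norm_le_iff_of_nonneg hε.le] at h
  push Not at h
  obtain ⟨ω, hω⟩ := h
  have hq' : (0 : ℝ) < q := by exact_mod_cast hq
  have habs : q * ε < |(l.count ω : ℝ) - q * f ω| := by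
    have : (l.count ω : ℝ) - q * f ω = q * ((empirical l - f) ω) := by
      simp only [empirical, Pi.sub_apply, hl]
      field_simp
    rw [this, abs_mul, abs_of_pos hq']
    exact mul_lt_mul_of_pos_left hω hq'
  obtain ⟨t, ht, hle⟩ : ∃ t ∈ ({4 * ε, -(4 * ε)} : Finset ℝ),
      4 * ε * (q * ε) ≤ t * ((l.count ω : ℝ) - q * f ω) := by
    rcases lt_abs.1 habs with h | h
    · exact ⟨4 * ε, by simp, mul_le_mul_of_nonneg_left h.le (by positivity)⟩
    · refine ⟨-(4 * ε), by simp, ?_⟩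
      have := mul_le_mul_of_nonneg_left h.le (show 0 ≤ 4 * ε by positivity)
      linarith
  unfold deviationBound
  refine le_trans ?_ (Finset.single_le_sum
    (fun ω _ => Finset.sum_nonneg fun _ _ => (Real.exp_pos _).le) (Finset.mem_univ ω))
  refine le_trans ?_ (Finset.single_le_sum (fun _ _ => (Real.exp_pos _).le) ht)
  rw [Real.one_le_exp_iff, hl]
  linarith

theorem deviationBound_nil_le {m : ℕ} (q : ℕ) {ε : ℝ} (f : Fin m → ℝ) :
    deviationBound q ε f [] ≤ 2 * m * Real.exp (-(2 * ε ^ 2 * q)) := by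
  unfold deviationBound
  have : ∀ ω ∈ (Finset.univ : Finset (Fin m)), ∑ t ∈ ({4 * ε, -(4 * ε)} : Finset ℝ),
      Real.exp (t * ((([] : List (Fin m)).count ω : ℝ) - ([] : List (Fin m)).length * f ω)
        + ((q : ℝ) - ([] : List (Fin m)).length) * (t ^ 2 / 8) - 4 * ε * (q * ε))
      ≤ 2 * Real.exp (-(2 * ε ^ 2 * q)) := by
    intro ω _
    have e : ∀ t ∈ ({4 * ε, -(4 * ε)} : Finset ℝ),
        Real.exp (t * ((([] : List (Fin m)).count ω : ℝ) - ([] : List (Fin m)).length * f ω)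
        + ((q : ℝ) - ([] : List (Fin m)).length) * (t ^ 2 / 8) - 4 * ε * (q * ε))
        = Real.exp (-(2 * ε ^ 2 * q)) := by
      intro t ht
      have : t ^ 2 = 16 * ε ^ 2 := by
        simp only [Finset.mem_insert, Finset.mem_singleton] at ht
        rcases ht with rfl | rfl <;> ring
      rw [this]
      congr 1
      simp
      ring
    rw [Finset.sum_congr rfl e, Finset.sum_const, nsmul_eq_mul]
    refine mul_le_mul_of_nonneg_right ?_ (Real.exp_pos _).le
    exact_mod_cast Finset.card_le_two
  refine (Finset.sum_le_sum this).trans (le_of_eq ?_)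
  simp
  ring

/-! ### Parameters and approximate best responses -/

/-- The hypotheses on the instance `P`, on the behaviour `astar` of the agent and on the inputs `X`
of the algorithm. -/
structure Setting {m : ℕ} (X : Input m) (P : PrincipalAgent X.n m)
    (astar : Contract m → Fin X.n) : Prop where
  response : P.IsAgentResponse astar
  r_eq : X.r = P.r
  one_le_B : 1 ≤ X.B
  ρ_mem : X.ρ ∈ Set.Ioo (0 : ℝ) 1
  δ_mem : X.δ ∈ Set.Ioo (0 : ℝ) 1

namespace Input

variable {m : ℕ} (X : Input m)

/-- A bound on the error caused by exchanging, in the expected payment of a contract, two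
distributions that belong to the same meta-action. -/
def swapError : ℝ := 4 * X.ε * X.n * (m * X.B)

/-- A bound on the error by which one call of `Find-HS` increases the error of the estimated cost
differences. -/
def stepError : ℝ := 4 * X.swapError + √(m : ℝ) * X.η / 2

/-- A bound on the regret of the agent when the representative action of a meta-action is played
under a contract of its lower bound. -/
def regret : ℝ := X.y + X.n * X.stepError

end Input

section

variable {m : ℕ} {X : Input m} {P : PrincipalAgent X.n m} {astar : Contract m → Fin X.n}

theorem Setting.n_pos (_h : Setting X P astar) : 0 < X.n := by
  obtain ⟨a, -⟩ := P.exists_cost_zero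
  exact a.pos

theorem Setting.m_pos (_h : Setting X P astar) : 0 < m := by
  obtain ⟨a, -⟩ := P.exists_cost_zero
  rcases Nat.eq_zero_or_pos m with rfl | hm
  · have := P.F_sum a
    simp at this
  · exact hm

theorem Setting.one_le_n (h : Setting X P astar) : (1 : ℝ) ≤ X.n := by
  exact_mod_cast h.n_pos

theorem Setting.one_le_m (h : Setting X P astar) : (1 : ℝ) ≤ m := by
  exact_mod_cast h.m_pos

theorem Setting.ε_pos (h : Setting X P astar) : 0 < X.ε := by
  have h1 := h.one_le_n
  have h2 := h.one_le_m
  have h3 := h.one_le_B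
  have h4 := h.ρ_mem.1
  unfold Input.ε
  positivity

theorem Setting.η_pos (h : Setting X P astar) : 0 < X.η := by
  have h1 := h.one_le_n
  have h2 := h.one_le_m
  have h3 := h.ε_pos
  unfold Input.η
  positivity

theorem Setting.swapError_nonneg (h : Setting X P astar) : 0 ≤ X.swapError := by
  have h3 := h.one_le_B
  have h4 := h.ε_pos
  unfold Input.swapError
  positivity

theorem Setting.stepError_nonneg (h : Setting X P astar) : 0 ≤ X.stepError := by
  have h3 := h.swapError_nonneg
  have h4 := h.η_pos
  unfold Input.stepError
  positivity

theorem Setting.n_mul_stepError_le_y (h : Setting X P astar) : X.n * X.stepError ≤ X.y := by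
  have h1 := h.one_le_n
  have h2 := h.η_pos
  have h3 := h.one_le_B
  have h4 := h.ε_pos
  have e1 : 0 ≤ X.B * X.ε * m * (X.n : ℝ) ^ 2 := by positivity
  have e2 : 0 ≤ X.n * X.η * √(m : ℝ) := by positivity
  unfold Input.stepError Input.swapError Input.y
  nlinarith

theorem Setting.regret_nonneg (h : Setting X P astar) : 0 ≤ X.regret := by
  have h1 := h.n_mul_stepError_le_y
  have h2 := h.stepError_nonneg
  have : 0 ≤ X.n * X.stepError := by positivity
  unfold Input.regret
  linarith

theorem Setting.regret_le (h : Setting X P astar) : X.regret ≤ 3 / 2 * X.γ := by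
  have h2 := h.η_pos
  have h3 := h.one_le_B
  have h4 := h.ε_pos
  have e1 : 0 ≤ X.B * X.ε * m * (X.n : ℝ) ^ 2 := by positivity
  have e2 : 0 ≤ X.n * X.η * √(m : ℝ) := by positivity
  unfold Input.regret Input.stepError Input.swapError Input.y Input.γ
  nlinarith

theorem zero_mem_region (h : Setting X P astar) : (0 : Contract m) ∈ X.region := by
  have := h.one_le_B
  refine ⟨fun _ => le_rfl, ?_⟩
  simp
  positivity

theorem abs_sum_mul_le {p : Contract m} (hp : p ∈ X.region) (f : Fin m → ℝ) :
    |∑ ω, f ω * p ω| ≤ ‖f‖ * (m * X.B) := by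
  calc |∑ ω, f ω * p ω| ≤ ∑ ω, |f ω * p ω| := Finset.abs_sum_le_sum_abs _ _
    _ ≤ ∑ ω, ‖f‖ * |p ω| := by
        refine Finset.sum_le_sum fun ω _ => ?_
        rw [abs_mul]
        exact mul_le_mul_of_nonneg_right (norm_le_pi_norm f ω) (abs_nonneg _)
    _ = ‖f‖ * ∑ ω, |p ω| := by rw [Finset.mul_sum]
    _ ≤ ‖f‖ * (m * X.B) := mul_le_mul_of_nonneg_left hp.2 (norm_nonneg f)

theorem boundedContracts_subset_region {p : Contract m} (hp : p ∈ boundedContracts m X.B) :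
    p ∈ X.region := by
  refine ⟨fun ω => (hp ω).1, ?_⟩
  calc ∑ ω, |p ω| ≤ ∑ _ω : Fin m, X.B :=
        Finset.sum_le_sum fun ω _ => by rw [abs_of_nonneg (hp ω).1]; exact (hp ω).2
    _ = m * X.B := by simp

/-- The expected payments of two actions under `p` differ by at least the difference of their costs
if the first of them is a best response. -/
theorem Setting.cost_sub_le (h : Setting X P astar) {p : Contract m} (hp : p ∈ X.region)
    (b : Fin X.n) :
    P.c (astar p) - P.c b ≤ ∑ ω, (P.F (astar p) ω - P.F b ω) * p ω := by
  have := (h.response p hp.1).1 b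
  simp only [PrincipalAgent.agentUtility] at this
  simp only [sub_mul, Finset.sum_sub_distrib]
  linarith

/-! ### The dictionary of meta-actions -/

/-- The actions of the meta-action `d`: those that are played under some contract of the region and
whose distribution is `ε`-close to a recorded empirical distribution. -/
def actionsOf (X : Input m) (P : PrincipalAgent X.n m) (astar : Contract m → Fin X.n)
    (T : Dictionary m) (d : ℕ) : Set (Fin X.n) :=
  {a | (∃ p ∈ X.region, astar p = a) ∧ ∃ G ∈ T.F d, ‖G - P.F a‖ ≤ X.ε}

/-- Two actions are adjacent when their distributions are `4 * ε`-close, so that they might have to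
be put into one meta-action. -/
def closeGraph (X : Input m) (P : PrincipalAgent X.n m) : SimpleGraph (Fin X.n) where
  Adj a b := a ≠ b ∧ ‖P.F a - P.F b‖ ≤ 4 * X.ε
  symm := ⟨fun a b hab => ⟨hab.1.symm, by rw [norm_sub_rev]; exact hab.2⟩⟩
  loopless := ⟨fun _ ha => ha.1 rfl⟩

theorem closeGraph_reachable_of_norm_le {a b : Fin X.n} (hab : ‖P.F a - P.F b‖ ≤ 4 * X.ε) :
    (closeGraph X P).Reachable a b := by
  rcases eq_or_ne a b with rfl | hne
  · exact SimpleGraph.Reachable.refl _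
  · exact SimpleGraph.Adj.reachable ⟨hne, hab⟩

theorem norm_sub_le_of_walk {a b : Fin X.n} (w : (closeGraph X P).Walk a b) :
    ‖P.F a - P.F b‖ ≤ 4 * X.ε * w.length := by
  induction w with
  | nil => simp
  | @cons a b c hab w ih =>
    calc ‖P.F a - P.F c‖ ≤ ‖P.F a - P.F b‖ + ‖P.F b - P.F c‖ := norm_sub_le_norm_sub_add_norm_sub _ _ _
      _ ≤ 4 * X.ε + 4 * X.ε * w.length := add_le_add hab.2 ih
      _ = _ := by push_cast [SimpleGraph.Walk.length_cons]; ring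

theorem norm_sub_le_of_reachable (hε : 0 ≤ X.ε) {a b : Fin X.n}
    (hab : (closeGraph X P).Reachable a b) :
    ‖P.F a - P.F b‖ ≤ 4 * X.ε * (X.n - 1) := by
  classical
  obtain ⟨w, hw⟩ := hab.exists_isPath
  have hl := hw.length_lt
  rw [Fintype.card_fin] at hl
  have : (w.length : ℝ) + 1 ≤ X.n := by exact_mod_cast hl
  exact (norm_sub_le_of_walk w).trans (mul_le_mul_of_nonneg_left (by linarith) (by positivity))

/-- The properties of the dictionary that hold as long as all the empirical distributions are
`ε`-close to the distributions they estimate: the meta-actions are the connected components of the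
set of recorded distributions, two of which are linked when they are `2 * ε`-close. -/
structure Consistent (X : Input m) (P : PrincipalAgent X.n m) (astar : Contract m → Fin X.n)
    (T : Dictionary m) : Prop where
  lt_fresh : ∀ d ∈ T.D, d < T.fresh
  separated : ∀ d ∈ T.D, ∀ e ∈ T.D, ∀ G ∈ T.F d, ∀ G' ∈ T.F e, ‖G - G'‖ ≤ 2 * X.ε → d = e
  rep_mem : ∀ d ∈ T.D, T.rep d ∈ T.F d
  exists_action : ∀ d ∈ T.D, ∀ G ∈ T.F d, ∃ p ∈ X.region, ‖G - P.F (astar p)‖ ≤ X.ε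
  reachable : ∀ d ∈ T.D, ∀ a ∈ actionsOf X P astar T d, ∀ b ∈ actionsOf X P astar T d,
    (closeGraph X P).Reachable a b

theorem consistent_empty : Consistent X P astar (Dictionary.empty m) := by
  constructor <;> simp [Dictionary.empty]

namespace Consistent

variable {T : Dictionary m}

theorem eq_of_mem_actionsOf (hT : Consistent X P astar T) {d e : ℕ} (hd : d ∈ T.D)
    (he : e ∈ T.D) {a : Fin X.n} (had : a ∈ actionsOf X P astar T d)
    (hae : a ∈ actionsOf X P astar T e) : d = e := by
  obtain ⟨-, G, hG, hGa⟩ := had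
  obtain ⟨-, G', hG', hGa'⟩ := hae
  refine hT.separated d hd e he G hG G' hG' ?_
  calc ‖G - G'‖ ≤ ‖G - P.F a‖ + ‖P.F a - G'‖ := norm_sub_le_norm_sub_add_norm_sub _ _ _
    _ ≤ X.ε + X.ε := add_le_add hGa (by rw [norm_sub_rev]; exact hGa')
    _ = _ := by ring

theorem norm_sub_le (hS : Setting X P astar) (hT : Consistent X P astar T) {d : ℕ} (hd : d ∈ T.D)
    {a b : Fin X.n} (ha : a ∈ actionsOf X P astar T d) (hb : b ∈ actionsOf X P astar T d) :
    ‖P.F a - P.F b‖ ≤ 4 * X.ε * X.n :=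
  (norm_sub_le_of_reachable hS.ε_pos.le (hT.reachable d hd a ha b hb)).trans
    (mul_le_mul_of_nonneg_left (by linarith) (by have := hS.ε_pos; positivity))

theorem exists_mem_actionsOf_rep (hT : Consistent X P astar T) {d : ℕ} (hd : d ∈ T.D) :
    ∃ a ∈ actionsOf X P astar T d, ‖T.rep d - P.F a‖ ≤ X.ε := by
  obtain ⟨p, hp, h⟩ := hT.exists_action d hd _ (hT.rep_mem d hd)
  exact ⟨astar p, ⟨⟨p, hp, rfl⟩, T.rep d, hT.rep_mem d hd, h⟩, h⟩

theorem norm_rep_sub_le (hS : Setting X P astar) (hT : Consistent X P astar T) {d : ℕ}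
    (hd : d ∈ T.D) {a : Fin X.n} (ha : a ∈ actionsOf X P astar T d) :
    ‖T.rep d - P.F a‖ ≤ 4 * X.ε * X.n := by
  obtain ⟨b, hb, hbr⟩ := hT.exists_mem_actionsOf_rep hd
  have h1 := norm_sub_le_of_reachable hS.ε_pos.le (hT.reachable d hd b hb a ha)
  have := hS.ε_pos
  calc ‖T.rep d - P.F a‖ ≤ ‖T.rep d - P.F b‖ + ‖P.F b - P.F a‖ :=
        norm_sub_le_norm_sub_add_norm_sub _ _ _
    _ ≤ 4 * X.ε * X.n := by nlinarith

theorem abs_sum_rep_sub_le (hS : Setting X P astar) (hT : Consistent X P astar T) {d : ℕ}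
    (hd : d ∈ T.D) {a : Fin X.n} (ha : a ∈ actionsOf X P astar T d) {p : Contract m}
    (hp : p ∈ X.region) :
    |∑ ω, T.rep d ω * p ω - ∑ ω, P.F a ω * p ω| ≤ X.swapError := by
  have h1 := abs_sum_mul_le hp (T.rep d - P.F a)
  have h2 := hS.one_le_B
  simp only [Pi.sub_apply, sub_mul, Finset.sum_sub_distrib] at h1
  exact h1.trans (mul_le_mul_of_nonneg_right (hT.norm_rep_sub_le hS hd ha) (by positivity))

theorem abs_sum_sub_le (hS : Setting X P astar) (hT : Consistent X P astar T) {d : ℕ}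
    (hd : d ∈ T.D) {a b : Fin X.n} (ha : a ∈ actionsOf X P astar T d)
    (hb : b ∈ actionsOf X P astar T d) {p : Contract m} (hp : p ∈ X.region) :
    |∑ ω, P.F a ω * p ω - ∑ ω, P.F b ω * p ω| ≤ X.swapError := by
  have h1 := abs_sum_mul_le hp (P.F a - P.F b)
  have h2 := hS.one_le_B
  simp only [Pi.sub_apply, sub_mul, Finset.sum_sub_distrib] at h1
  exact h1.trans (mul_le_mul_of_nonneg_right (hT.norm_sub_le hS hd ha hb) (by positivity))

theorem cost_sub_le (hS : Setting X P astar) (hT : Consistent X P astar T) {d : ℕ} (hd : d ∈ T.D)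
    {a b : Fin X.n} (ha : a ∈ actionsOf X P astar T d) (hb : b ∈ actionsOf X P astar T d) :
    P.c a - P.c b ≤ X.swapError := by
  obtain ⟨p, hp, rfl⟩ := ha.1
  have h1 := hS.cost_sub_le hp b
  have h2 := (abs_le.1 (hT.abs_sum_sub_le hS hd ha hb hp)).2
  simp only [sub_mul, Finset.sum_sub_distrib] at h1
  linarith

theorem abs_cost_sub_le (hS : Setting X P astar) (hT : Consistent X P astar T) {d : ℕ}
    (hd : d ∈ T.D) {a b : Fin X.n} (ha : a ∈ actionsOf X P astar T d)
    (hb : b ∈ actionsOf X P astar T d) : |P.c a - P.c b| ≤ X.swapError :=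
  abs_le.2 ⟨by linarith [hT.cost_sub_le hS hd hb ha], hT.cost_sub_le hS hd ha hb⟩

end Consistent

open Classical in
/-- The actions that belong to some meta-action. -/
def discoveredActions (X : Input m) (P : PrincipalAgent X.n m) (astar : Contract m → Fin X.n)
    (T : Dictionary m) : Finset (Fin X.n) :=
  Finset.univ.filter fun a => ∃ d ∈ T.D, a ∈ actionsOf X P astar T d

/-- The progress made by the restarts of `Try-Cover`: a restart either discovers an action, or merges
meta-actions. -/
def progress (X : Input m) (P : PrincipalAgent X.n m) (astar : Contract m → Fin X.n)
    (T : Dictionary m) : ℕ :=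
  2 * (discoveredActions X P astar T).card - T.D.card

theorem mem_discoveredActions {T : Dictionary m} {a : Fin X.n} :
    a ∈ discoveredActions X P astar T ↔ ∃ d ∈ T.D, a ∈ actionsOf X P astar T d := by
  simp [discoveredActions]

theorem card_discoveredActions_le (T : Dictionary m) :
    (discoveredActions X P astar T).card ≤ X.n := by
  simpa using Finset.card_le_univ (discoveredActions X P astar T)

theorem Consistent.card_le {T : Dictionary m} (hT : Consistent X P astar T) :
    T.D.card ≤ (discoveredActions X P astar T).card := by
  have h : ∀ d ∈ T.D, ∃ a, a ∈ actionsOf X P astar T d := fun d hd =>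
    let ⟨a, ha, _⟩ := hT.exists_mem_actionsOf_rep hd
    ⟨a, ha⟩
  rcases T.D.eq_empty_or_nonempty with h0 | ⟨d0, hd0⟩
  · simp [h0]
  have : Nonempty (Fin X.n) := ⟨(h d0 hd0).choose⟩
  choose! f hf using h
  refine Finset.card_le_card_of_injOn f
    (fun d hd => mem_discoveredActions.2 ⟨d, hd, hf d hd⟩) ?_
  intro d hd e he hde
  refine hT.eq_of_mem_actionsOf hd he (hf d hd) ?_
  rw [hde]
  exact hf e he

theorem mem_near {T : Dictionary m} {ε : ℝ} {G : Fin m → ℝ} {d : ℕ} :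
    d ∈ T.near ε G ↔ d ∈ T.D ∧ ∃ F ∈ T.F d, ‖F - G‖ ≤ 2 * ε := by
  simp [Dictionary.near]

/-- The distribution of an action of `d` links every empirical distribution of that action
to `d`. -/
theorem mem_near_of_mem_actionsOf {T : Dictionary m} {G : Fin m → ℝ} {a : Fin X.n}
    (hG : ‖G - P.F a‖ ≤ X.ε) {d : ℕ} (hd : d ∈ T.D) (ha : a ∈ actionsOf X P astar T d) :
    d ∈ T.near X.ε G := by
  obtain ⟨-, G', hG', hGa'⟩ := ha
  refine mem_near.2 ⟨hd, G', hG', ?_⟩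
  calc ‖G' - G‖ ≤ ‖G' - P.F a‖ + ‖P.F a - G‖ := norm_sub_le_norm_sub_add_norm_sub _ _ _
    _ ≤ X.ε + X.ε := add_le_add hGa' (by rw [norm_sub_rev]; exact hG)
    _ = _ := by ring

/-- The actions that `G` is an empirical distribution of are close to some action of every
meta-action near `G`. -/
theorem exists_reachable_of_mem_near {T : Dictionary m} (hT : Consistent X P astar T)
    {G : Fin m → ℝ} {b : Fin X.n} (hb : ‖G - P.F b‖ ≤ X.ε) {d : ℕ} (hd : d ∈ T.near X.ε G) :
    ∃ a ∈ actionsOf X P astar T d, (closeGraph X P).Reachable b a := by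
  obtain ⟨hdD, G', hG', hGG⟩ := mem_near.1 hd
  obtain ⟨p, hp, hGp⟩ := hT.exists_action d hdD G' hG'
  refine ⟨astar p, ⟨⟨p, hp, rfl⟩, G', hG', hGp⟩, closeGraph_reachable_of_norm_le ?_⟩
  calc ‖P.F b - P.F (astar p)‖ ≤ ‖P.F b - G‖ + ‖G - P.F (astar p)‖ :=
        norm_sub_le_norm_sub_add_norm_sub _ _ _
    _ ≤ ‖P.F b - G‖ + (‖G - G'‖ + ‖G' - P.F (astar p)‖) := by
        gcongr; exact norm_sub_le_norm_sub_add_norm_sub _ _ _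
    _ ≤ X.ε + (2 * X.ε + X.ε) := by
        rw [norm_sub_rev _ G, norm_sub_rev G G']
        gcongr
    _ = _ := by ring

section record

variable {T T' : Dictionary m} {p : Contract m} {G : Fin m → ℝ}

/-- When `Action-Oracle` returns a meta-action, the dictionary stays consistent, and the action that
has been played belongs to that meta-action. -/
theorem Consistent.of_record_eq_some (hT : Consistent X P astar T) (hp : p ∈ X.region)
    (hG : ‖G - P.F (astar p)‖ ≤ X.ε) {d : ℕ} (h : T.record X.ε G = (some d, T')) :
    d ∈ T.D ∧ Consistent X P astar T' ∧ T'.D = T.D ∧ T'.rep = T.rep ∧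
      (∀ e, actionsOf X P astar T e ⊆ actionsOf X P astar T' e) ∧
      astar p ∈ actionsOf X P astar T' d := by
  unfold Dictionary.record at h
  split_ifs at h with hex
  swap
  · cases h
  have hs := hex.choose_spec
  set d' := hex.choose with hd'
  obtain ⟨h1, rfl⟩ := Prod.mk.inj h
  obtain rfl : d' = d := Option.some.inj h1
  clear_value d'
  have hnear : d' ∈ T.near X.ε G := by rw [hs]; exact Finset.mem_singleton_self _
  have hdD := (mem_near.1 hnear).1
  have hF : ∀ e, ∀ G', G' ∈ Function.update T.F d' (insert G (T.F d')) e →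
      G' ∈ T.F e ∨ (e = d' ∧ G' = G) := by
    intro e G' hG'
    rcases eq_or_ne e d' with rfl | hne
    · rw [Function.update_self] at hG'
      rcases hG' with h | h
      · exact Or.inr ⟨rfl, h⟩
      · exact Or.inl h
    · rw [Function.update_of_ne hne] at hG'
      exact Or.inl hG'
  have hF' : ∀ e, T.F e ⊆ Function.update T.F d' (insert G (T.F d')) e := by
    intro e
    rcases eq_or_ne e d' with rfl | hne
    · rw [Function.update_self]; exact Set.subset_insert _ _
    · rw [Function.update_of_ne hne]
  refine ⟨hdD, ⟨hT.lt_fresh, ?_, fun e he => hF' e (hT.rep_mem e he), ?_, ?_⟩, rfl, rfl, ?_, ?_⟩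
  · intro e he e' he' G₁ hG₁ G₂ hG₂ hle
    rcases hF e G₁ hG₁ with h₁ | ⟨rfl, rfl⟩ <;> rcases hF e' G₂ hG₂ with h₂ | ⟨rfl, rfl⟩
    · exact hT.separated e he e' he' G₁ h₁ G₂ h₂ hle
    · have : e ∈ T.near X.ε G₂ := mem_near.2 ⟨he, G₁, h₁, hle⟩
      rw [hs] at this
      exact Finset.mem_singleton.1 this
    · have : e' ∈ T.near X.ε G₁ := mem_near.2 ⟨he', G₂, h₂, by rw [norm_sub_rev]; exact hle⟩
      rw [hs] at this
      exact (Finset.mem_singleton.1 this).symm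
    · rfl
  · intro e he G₁ hG₁
    rcases hF e G₁ hG₁ with h₁ | ⟨rfl, rfl⟩
    · exact hT.exists_action e he G₁ h₁
    · exact ⟨p, hp, hG⟩
  · intro e he
    -- every action of the enlarged meta-action is linked to an action of the old one
    have key : ∀ a ∈ actionsOf X P astar
        { T with F := Function.update T.F d' (insert G (T.F d')) } e,
        ∃ a' ∈ actionsOf X P astar T e, (closeGraph X P).Reachable a a' := by
      rintro a ⟨ha, G₁, hG₁, hGa⟩
      rcases hF e G₁ hG₁ with h₁ | ⟨rfl, rfl⟩
      · exact ⟨a, ⟨ha, G₁, h₁, hGa⟩, SimpleGraph.Reachable.refl _⟩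
      · exact exists_reachable_of_mem_near hT hGa hnear
    intro a ha b hb
    obtain ⟨a', ha', hra⟩ := key a ha
    obtain ⟨b', hb', hrb⟩ := key b hb
    exact hra.trans ((hT.reachable e he a' ha' b' hb').trans hrb.symm)
  · rintro e a ⟨ha, G₁, hG₁, hGa⟩
    exact ⟨ha, G₁, hF' e hG₁, hGa⟩
  · exact ⟨⟨p, hp, rfl⟩, G, by simp, hG⟩

/-- When `Action-Oracle` returns `⊥`, the dictionary stays consistent, and there is progress. -/
theorem Consistent.of_record_eq_none (hT : Consistent X P astar T) (hp : p ∈ X.region)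
    (hG : ‖G - P.F (astar p)‖ ≤ X.ε) (h : T.record X.ε G = (none, T')) :
    Consistent X P astar T' ∧ progress X P astar T < progress X P astar T' ∧ T'.D.Nonempty := by
  classical
  unfold Dictionary.record at h
  split_ifs at h with hex
  · cases h
  obtain ⟨-, rfl⟩ := Prod.mk.inj h
  set T' : Dictionary m :=
    { D := insert T.fresh (T.D \ T.near X.ε G)
      fresh := T.fresh + 1
      F := fun d =>
        if d = T.fresh then insert G (⋃ e ∈ T.near X.ε G, T.F e)
        else if d ∈ T.near X.ε G then ∅
        else T.F d
      rep := Function.update T.rep T.fresh G } with hT'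
  have hfresh : T.fresh ∉ T.D := fun h => lt_irrefl _ (hT.lt_fresh _ h)
  have hD : ∀ d, d ∈ T'.D ↔ d = T.fresh ∨ d ∈ T.D ∧ d ∉ T.near X.ε G := by
    intro d; simp [hT']
  have hFf : T'.F T.fresh = insert G (⋃ e ∈ T.near X.ε G, T.F e) := by simp [hT']
  have hFo : ∀ d, d ∈ T.D → d ∉ T.near X.ε G → T'.F d = T.F d := by
    intro d hd hn
    have : d ≠ T.fresh := fun h => hfresh (h ▸ hd)
    simp [hT', this, hn]
  have hmem : ∀ G', G' ∈ T'.F T.fresh ↔ G' = G ∨ ∃ e ∈ T.near X.ε G, G' ∈ T.F e := by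
    intro G'; rw [hFf]; simp
  -- no distribution of a remaining meta-action is close to one of the new meta-action
  have hsep : ∀ d ∈ T.D, d ∉ T.near X.ε G → ∀ G₁ ∈ T.F d, ∀ G₂ ∈ T'.F T.fresh,
      ¬ ‖G₁ - G₂‖ ≤ 2 * X.ε := by
    intro d hd hn G₁ hG₁ G₂ hG₂ hle
    rcases (hmem G₂).1 hG₂ with rfl | ⟨e, he, hG₂⟩
    · exact hn (mem_near.2 ⟨hd, G₁, hG₁, hle⟩)
    · rw [hT.separated d hd e (mem_near.1 he).1 G₁ hG₁ G₂ hG₂ hle] at hn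
      exact hn he
  have hcons : Consistent X P astar T' := by
    refine ⟨?_, ?_, ?_, ?_, ?_⟩
    · intro d hd
      rcases (hD d).1 hd with rfl | ⟨hd, -⟩
      · exact Nat.lt_succ_self _
      · exact (hT.lt_fresh d hd).trans (Nat.lt_succ_self _)
    · intro d hd e he G₁ hG₁ G₂ hG₂ hle
      rcases (hD d).1 hd with rfl | ⟨hd, hdn⟩ <;> rcases (hD e).1 he with rfl | ⟨he, hen⟩
      · rfl
      · rw [hFo e he hen] at hG₂
        exact absurd (by rwa [norm_sub_rev]) (hsep e he hen G₂ hG₂ G₁ hG₁)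
      · rw [hFo d hd hdn] at hG₁
        exact absurd hle (hsep d hd hdn G₁ hG₁ G₂ hG₂)
      · rw [hFo e he hen] at hG₂
        rw [hFo d hd hdn] at hG₁
        exact hT.separated d hd e he G₁ hG₁ G₂ hG₂ hle
    · intro d hd
      rcases (hD d).1 hd with rfl | ⟨hd, hdn⟩
      · rw [hmem]; left; simp [hT']
      · have : d ≠ T.fresh := fun h => hfresh (h ▸ hd)
        rw [hFo d hd hdn]
        simpa [hT', this] using hT.rep_mem d hd
    · intro d hd G₁ hG₁
      rcases (hD d).1 hd with rfl | ⟨hd, hdn⟩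
      · rcases (hmem G₁).1 hG₁ with rfl | ⟨e, he, hG₁⟩
        · exact ⟨p, hp, hG⟩
        · exact hT.exists_action e (mem_near.1 he).1 G₁ hG₁
      · rw [hFo d hd hdn] at hG₁
        exact hT.exists_action d hd G₁ hG₁
    · intro d hd a ha b hb
      rcases (hD d).1 hd with rfl | ⟨hd, hdn⟩
      · -- all the actions of the new meta-action are linked to the action just played
        have key : ∀ a ∈ actionsOf X P astar T' T.fresh,
            (closeGraph X P).Reachable a (astar p) := by
          rintro a ⟨ha, G₁, hG₁, hGa⟩
          rcases (hmem G₁).1 hG₁ with rfl | ⟨e, he, hG₁⟩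
          · refine closeGraph_reachable_of_norm_le ?_
            have h0 : 0 ≤ X.ε := (norm_nonneg _).trans hGa
            calc ‖P.F a - P.F (astar p)‖ ≤ ‖P.F a - G₁‖ + ‖G₁ - P.F (astar p)‖ :=
                  norm_sub_le_norm_sub_add_norm_sub _ _ _
              _ ≤ X.ε + X.ε := add_le_add (by rw [norm_sub_rev]; exact hGa) hG
              _ ≤ _ := by linarith
          · obtain ⟨a', ha', hr⟩ := exists_reachable_of_mem_near hT hG he
            exact (hT.reachable e (mem_near.1 he).1 a ⟨ha, G₁, hG₁, hGa⟩ a' ha').trans hr.symm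
        exact (key a ha).trans (key b hb).symm
      · obtain ⟨ha, G₁, hG₁, hGa⟩ := ha
        obtain ⟨hb, G₂, hG₂, hGb⟩ := hb
        rw [hFo d hd hdn] at hG₁ hG₂
        exact hT.reachable d hd a ⟨ha, G₁, hG₁, hGa⟩ b ⟨hb, G₂, hG₂, hGb⟩
  have hsub : discoveredActions X P astar T ⊆ discoveredActions X P astar T' := by
    intro a ha
    obtain ⟨d, hd, ha, G₁, hG₁, hGa⟩ := mem_discoveredActions.1 ha
    refine mem_discoveredActions.2 ?_
    by_cases hn : d ∈ T.near X.ε G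
    · exact ⟨T.fresh, (hD _).2 (Or.inl rfl), ha, G₁, (hmem _).2 (Or.inr ⟨d, hn, hG₁⟩), hGa⟩
    · exact ⟨d, (hD _).2 (Or.inr ⟨hd, hn⟩), ha, G₁, by rwa [hFo d hd hn], hGa⟩
  have hcard : T'.D.card + (T.near X.ε G).card = T.D.card + 1 := by
    have h1 : T'.D.card = (T.D \ T.near X.ε G).card + 1 :=
      Finset.card_insert_of_notMem fun h => hfresh (Finset.mem_sdiff.1 h).1
    have h2 := Finset.card_sdiff_add_card_eq_card (s := T.near X.ε G) (t := T.D)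
      fun d hd => (mem_near.1 hd).1
    omega
  refine ⟨hcons, ?_, ⟨T.fresh, (hD _).2 (Or.inl rfl)⟩⟩
  have hle := Finset.card_le_card hsub
  have h1 := hT.card_le
  have h2 := hcons.card_le
  unfold progress
  rcases Nat.lt_or_ge (T.near X.ε G).card 2 with hlt | hge
  · have hne1 : (T.near X.ε G).card ≠ 1 := by
      intro h
      obtain ⟨d, hd⟩ := Finset.card_eq_one.1 h
      exact hex ⟨d, hd⟩
    have h0 : T.near X.ε G = ∅ := Finset.card_eq_zero.1 (by omega)
    have hlt : (discoveredActions X P astar T).card < (discoveredActions X P astar T').card := by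
      refine Finset.card_lt_card ((Finset.ssubset_iff_of_subset hsub).2 ⟨astar p, ?_, ?_⟩)
      · exact mem_discoveredActions.2 ⟨T.fresh, (hD _).2 (Or.inl rfl), ⟨p, hp, rfl⟩, G,
          (hmem _).2 (Or.inl rfl), hG⟩
      · intro h
        obtain ⟨d, hd, ha⟩ := mem_discoveredActions.1 h
        have := mem_near_of_mem_actionsOf hG hd ha
        rw [h0] at this
        simp at this
    rw [h0, Finset.card_empty] at hcard
    omega
  · omega

theorem progress_le_of_subset (hD : T'.D = T.D)
    (hA : ∀ e, actionsOf X P astar T e ⊆ actionsOf X P astar T' e) :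
    progress X P astar T ≤ progress X P astar T' := by
  have : discoveredActions X P astar T ⊆ discoveredActions X P astar T' := by
    intro a ha
    obtain ⟨d, hd, ha⟩ := mem_discoveredActions.1 ha
    exact mem_discoveredActions.2 ⟨d, hD ▸ hd, hA d ha⟩
  have := Finset.card_le_card this
  unfold progress
  rw [hD]
  omega

end record

/-! ### The bounds on the best-response regions -/

/-- The contracts under which the agent loses at most `X.regret` by playing `a`. -/
def nearBest (X : Input m) (P : PrincipalAgent X.n m) (a : Fin X.n) : Set (Contract m) :=
  {p | ∀ b, P.agentUtility p b ≤ P.agentUtility p a + X.regret}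

/-- The invariant of `Try-Cover`. The action played under the seed of a meta-action represents this
meta-action, so that the estimates refer to actions that do not change during a run. -/
structure CoverInvariant (X : Input m) (P : PrincipalAgent X.n m) (astar : Contract m → Fin X.n)
    (T : Dictionary m) (S : Cover m) : Prop where
  mem_D : ∀ d, (S.L d).Nonempty → d ∈ T.D
  seed_mem : ∀ d, (S.L d).Nonempty → S.seed d ∈ X.region
  seed_action : ∀ d, (S.L d).Nonempty → astar (S.seed d) ∈ actionsOf X P astar T d
  nonempty_of_mem_C : ∀ d ∈ S.C, (S.L d).Nonempty
  hull : ∀ d, ∃ K : Set (Contract m), K.Finite ∧ S.L d = convexHull ℝ K ∧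
    K ⊆ X.region ∩ nearBest X P (astar (S.seed d))
  self_mem : ∀ i, i ∈ S.E i
  nonempty_of_mem_E : ∀ i, ∀ k ∈ S.E i, k ≠ i → (S.L i).Nonempty ∧ (S.L k).Nonempty
  U_eq : ∀ i, S.U i = X.region ∩
    {p | ∀ k ∈ S.E i, k ≠ i → S.Δc i k - X.y ≤ ∑ ω, (T.rep i ω - T.rep k ω) * p ω}
  abs_Δc_sub_le : ∀ i, ∀ k ∈ S.E i, k ≠ i →
    |S.Δc i k - (P.c (astar (S.seed i)) - P.c (astar (S.seed k)))|
      ≤ ((S.E i).card - 1) * X.stepError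
  U_subset_L : ∀ i, (S.L i).Nonempty → i ∉ S.C → S.U i ⊆ S.L i

theorem convex_region : Convex ℝ X.region := by
  have h : X.region = {p : Contract m | (∀ ω, 0 ≤ p ω) ∧ ∑ ω, p ω ≤ m * X.B} := by
    ext p
    refine and_congr_right fun hp => ?_
    rw [Finset.sum_congr rfl fun ω _ => abs_of_nonneg (hp ω)]
  rw [h]
  intro p hp p' hp' s t hs ht hst
  refine ⟨fun ω => ?_, ?_⟩
  · have h1 := hp.1 ω
    have h2 := hp'.1 ω
    simp only [Pi.add_apply, Pi.smul_apply, smul_eq_mul]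
    positivity
  · simp only [Pi.add_apply, Pi.smul_apply, smul_eq_mul, Finset.sum_add_distrib, ← Finset.mul_sum]
    calc s * ∑ ω, p ω + t * ∑ ω, p' ω ≤ s * (m * X.B) + t * (m * X.B) :=
          add_le_add (mul_le_mul_of_nonneg_left hp.2 hs) (mul_le_mul_of_nonneg_left hp'.2 ht)
      _ = m * X.B := by rw [← add_mul, hst, one_mul]

theorem isCompact_region : IsCompact X.region := by
  refine Metric.isCompact_of_isClosed_isBounded ?_ ?_
  · have h : X.region = (⋂ ω, {p : Contract m | 0 ≤ p ω}) ∩ {p | ∑ ω, |p ω| ≤ m * X.B} := by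
      ext p; simp [Input.region]
    rw [h]
    exact (isClosed_iInter fun ω => isClosed_le continuous_const (continuous_apply ω)).inter
      (isClosed_le (by fun_prop) continuous_const)
  · refine (Metric.isBounded_closedBall (x := (0 : Contract m)) (r := m * X.B)).subset fun p hp => ?_
    rw [mem_closedBall_zero_iff]
    have h0 : 0 ≤ m * X.B := (Finset.sum_nonneg fun ω _ => abs_nonneg (p ω)).trans hp.2
    rw [pi_norm_le_iff_of_nonneg h0]
    exact fun ω => (Finset.single_le_sum (f := fun ω => |p ω|) (fun ω _ => abs_nonneg _)
      (Finset.mem_univ ω)).trans hp.2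

theorem convex_nearBest (a : Fin X.n) : Convex ℝ (nearBest X P a) := by
  intro p hp p' hp' s t hs ht hst b
  have h1 := mul_le_mul_of_nonneg_left (hp b) hs
  have h2 := mul_le_mul_of_nonneg_left (hp' b) ht
  have key : ∀ a, P.agentUtility (s • p + t • p') a
      = s * P.agentUtility p a + t * P.agentUtility p' a := by
    intro a
    have : P.c a = s * P.c a + t * P.c a := by rw [← add_mul, hst, one_mul]
    simp only [PrincipalAgent.agentUtility, Pi.add_apply, Pi.smul_apply, smul_eq_mul, mul_sub,
      mul_add, Finset.sum_add_distrib, Finset.mul_sum]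
    rw [Finset.sum_congr rfl fun ω _ => mul_left_comm (P.F a ω) s (p ω),
      Finset.sum_congr rfl fun ω _ => mul_left_comm (P.F a ω) t (p' ω)]
    linarith
  rw [key, key]
  have : X.regret = s * X.regret + t * X.regret := by rw [← add_mul, hst, one_mul]
  linarith

namespace CoverInvariant

variable {T : Dictionary m} {S : Cover m}

theorem L_subset (hI : CoverInvariant X P astar T S) (d : ℕ) :
    S.L d ⊆ X.region ∩ nearBest X P (astar (S.seed d)) := by
  obtain ⟨K, -, hK, hsub⟩ := hI.hull d
  rw [hK]
  exact convexHull_min hsub (convex_region.inter (convex_nearBest _))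

theorem isCompact_L (hI : CoverInvariant X P astar T S) (d : ℕ) : IsCompact (S.L d) := by
  obtain ⟨K, hfin, hK, -⟩ := hI.hull d
  rw [hK]
  exact hfin.isCompact_convexHull ℝ

theorem convex_L (hI : CoverInvariant X P astar T S) (d : ℕ) : Convex ℝ (S.L d) := by
  obtain ⟨K, -, hK, -⟩ := hI.hull d
  rw [hK]
  exact convex_convexHull ℝ K

theorem E_subset (hI : CoverInvariant X P astar T S) {i : ℕ} (hi : (S.L i).Nonempty) :
    S.E i ⊆ T.D := by
  intro k hk
  rcases eq_or_ne k i with rfl | hne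
  · exact hI.mem_D _ hi
  · exact hI.mem_D _ (hI.nonempty_of_mem_E i k hk hne).2

theorem nonempty_L_of_mem_E (hI : CoverInvariant X P astar T S) {i k : ℕ} (hi : (S.L i).Nonempty)
    (hk : k ∈ S.E i) : (S.L k).Nonempty := by
  rcases eq_or_ne k i with rfl | hne
  · exact hi
  · exact (hI.nonempty_of_mem_E i k hk hne).2

theorem card_E_le (hT : Consistent X P astar T) (hI : CoverInvariant X P astar T S) {i : ℕ}
    (hi : (S.L i).Nonempty) : (S.E i).card ≤ X.n :=
  (Finset.card_le_card (hI.E_subset hi)).trans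
    (hT.card_le.trans (card_discoveredActions_le T))

theorem card_E_mul_le (hS : Setting X P astar) (hT : Consistent X P astar T)
    (hI : CoverInvariant X P astar T S) {i : ℕ} (hi : (S.L i).Nonempty) :
    ((S.E i).card - 1) * X.stepError + 4 * X.swapError ≤ X.n * X.stepError := by
  have h1 : ((S.E i).card : ℝ) ≤ X.n := by exact_mod_cast hI.card_E_le hT hi
  have h2 := mul_le_mul_of_nonneg_right h1 hS.stepError_nonneg
  have h3 : 4 * X.swapError ≤ X.stepError := by
    have := hS.η_pos
    unfold Input.stepError
    have : 0 ≤ √(m : ℝ) * X.η / 2 := by positivity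
    linarith
  linarith

/-- The upper bound of `i` contains every contract at which the representative action of `i` is at
least as good for the agent as those of the other meta-actions. -/
theorem mem_U (hS : Setting X P astar) (hT : Consistent X P astar T)
    (hI : CoverInvariant X P astar T S) {i : ℕ} (hi : (S.L i).Nonempty) {p : Contract m}
    (hp : p ∈ X.region) (h : ∀ k, (S.L k).Nonempty →
      P.agentUtility p (astar (S.seed k)) ≤ P.agentUtility p (astar (S.seed i))) :
    p ∈ S.U i := by
  rw [hI.U_eq]
  refine ⟨hp, fun k hk hki => ?_⟩
  have hk' := (hI.nonempty_of_mem_E i k hk hki).2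
  have h1 := h k hk'
  have h2 := (abs_le.1 (hI.abs_Δc_sub_le i k hk hki)).2
  have h3 := (abs_le.1 (hT.abs_sum_rep_sub_le hS (hI.mem_D i hi) (hI.seed_action i hi) hp)).1
  have h4 := (abs_le.1 (hT.abs_sum_rep_sub_le hS (hI.mem_D k hk') (hI.seed_action k hk') hp)).2
  have h5 := hI.card_E_mul_le hS hT hi
  have h6 := hS.n_mul_stepError_le_y
  have h7 := hS.swapError_nonneg
  simp only [PrincipalAgent.agentUtility] at h1
  simp only [sub_mul, Finset.sum_sub_distrib]
  linarith

theorem seed_mem_U (hS : Setting X P astar) (hT : Consistent X P astar T)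
    (hI : CoverInvariant X P astar T S) {i : ℕ} (hi : (S.L i).Nonempty) : S.seed i ∈ S.U i :=
  hI.mem_U hS hT hi (hI.seed_mem i hi) fun _ _ =>
    (hS.response _ (hI.seed_mem i hi).1).1 _

/-- At a contract of the upper bound of `i` at which an action of some `k ∈ E i` is played, the
regret of the representative action of `i` is small. -/
theorem mem_nearBest (hS : Setting X P astar) (hT : Consistent X P astar T)
    (hI : CoverInvariant X P astar T S) {i : ℕ} (hi : (S.L i).Nonempty) {p : Contract m}
    (hp : p ∈ S.U i) {k : ℕ} (hk : k ∈ S.E i) (hpk : astar p ∈ actionsOf X P astar T k) :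
    p ∈ nearBest X P (astar (S.seed i)) := by
  have hU := hp
  rw [hI.U_eq] at hU
  obtain ⟨hpr, hpE⟩ := hU
  intro b
  refine ((hS.response p hpr.1).1 b).trans ?_
  have h7 := hS.swapError_nonneg
  have h5 := hI.card_E_mul_le hS hT hi
  have h8 : (0 : ℝ) ≤ ((S.E i).card - 1) * X.stepError := by
    have : 1 ≤ (S.E i).card := Finset.card_pos.2 ⟨i, hI.self_mem i⟩
    have : (1 : ℝ) ≤ (S.E i).card := by exact_mod_cast this
    exact mul_nonneg (by linarith) hS.stepError_nonneg
  have h9 := hS.n_mul_stepError_le_y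
  rcases eq_or_ne k i with rfl | hki
  · have h1 := (abs_le.1 (hT.abs_sum_sub_le hS (hI.mem_D k hi) hpk (hI.seed_action k hi) hpr)).2
    have h2 := (abs_le.1 (hT.abs_cost_sub_le hS (hI.mem_D k hi) hpk (hI.seed_action k hi))).1
    simp only [PrincipalAgent.agentUtility, Input.regret]
    linarith
  · have hk' := (hI.nonempty_of_mem_E i k hk hki).2
    have h1 := hpE k hk hki
    have h2 := (abs_le.1 (hI.abs_Δc_sub_le i k hk hki)).1
    have h3 := (abs_le.1 (hT.abs_sum_rep_sub_le hS (hI.mem_D i hi) (hI.seed_action i hi) hpr)).2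
    have h4 := (abs_le.1 (hT.abs_sum_rep_sub_le hS (hI.mem_D k hk') hpk hpr)).1
    have h6 := (abs_le.1 (hT.abs_cost_sub_le hS (hI.mem_D k hk') hpk (hI.seed_action k hk'))).1
    simp only [sub_mul, Finset.sum_sub_distrib] at h1
    simp only [PrincipalAgent.agentUtility, Input.regret]
    linarith

theorem U_subset_region (hI : CoverInvariant X P astar T S) (i : ℕ) : S.U i ⊆ X.region := by
  rw [hI.U_eq]; exact Set.inter_subset_left

/-- The upper bounds are polyhedra with at most `m + n + 1` facets. -/
theorem extremePoints_U (hI : CoverInvariant X P astar T S) (hT : Consistent X P astar T) {i : ℕ}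
    (hi : (S.L i).Nonempty) :
    ((S.U i).extremePoints ℝ).Finite ∧
      ((S.U i).extremePoints ℝ).ncard ≤ (m + X.n + 1).choose m := by
  let α : Fin m ⊕ Unit ⊕ {k // k ∈ (S.E i).erase i} → Fin m → ℝ :=
    Sum.elim (fun ω => Pi.single ω (-1)) (Sum.elim (fun _ _ => 1) fun k => T.rep k - T.rep i)
  let β : Fin m ⊕ Unit ⊕ {k // k ∈ (S.E i).erase i} → ℝ :=
    Sum.elim (fun _ => 0) (Sum.elim (fun _ => m * X.B) fun k => X.y - S.Δc i k)
  have h := extremePoints_polyhedron_finite α β (S.U i) (by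
    rw [hI.U_eq]
    ext p
    have e : ∀ k, (S.Δc i k - X.y ≤ ∑ ω, (T.rep i ω - T.rep k ω) * p ω ↔
        ∑ ω, (T.rep k - T.rep i) ω * p ω ≤ X.y - S.Δc i k) := by
      intro k
      simp only [Pi.sub_apply, sub_mul, Finset.sum_sub_distrib]
      constructor <;> intro h <;> linarith
    simp only [Input.region, Set.mem_inter_iff, Set.mem_ofPred_eq, Sum.forall, α, β, Sum.elim_inl,
      Sum.elim_inr, forall_const, Subtype.forall, Finset.mem_erase, e, one_mul]
    have e2 : ∀ ω, (∑ ω', Pi.single (M := fun _ => ℝ) ω (-1) ω' * p ω' ≤ 0 ↔ 0 ≤ p ω) := by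
      intro ω
      simp [Pi.single_apply]
    simp only [e2]
    constructor
    · rintro ⟨⟨h0, h1⟩, h2⟩
      rw [Finset.sum_congr rfl fun ω _ => abs_of_nonneg (h0 ω)] at h1
      exact ⟨h0, h1, fun k hk => h2 k hk.2 hk.1⟩
    · rintro ⟨h0, h1, h2⟩
      rw [← Finset.sum_congr rfl fun ω _ => abs_of_nonneg (h0 ω)] at h1
      exact ⟨⟨h0, h1⟩, fun k hk hki => h2 k ⟨hki, hk⟩⟩)
  refine ⟨h.1, h.2.trans (Nat.choose_le_choose m ?_)⟩
  have h1 := hI.card_E_le hT hi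
  have h2 := Finset.card_erase_of_mem (hI.self_mem i)
  simp only [Fintype.card_sum, Fintype.card_fin, Fintype.card_unit, Fintype.card_coe, h2]
  omega

theorem convex_U (hI : CoverInvariant X P astar T S) (i : ℕ) : Convex ℝ (S.U i) := by
  rw [hI.U_eq]
  refine convex_region.inter ?_
  have : {p : Contract m | ∀ k ∈ S.E i, k ≠ i →
      S.Δc i k - X.y ≤ ∑ ω, (T.rep i ω - T.rep k ω) * p ω}
      = ⋂ k ∈ S.E i, ⋂ (_ : k ≠ i),
        {p | S.Δc i k - X.y ≤ Fintype.linearCombination ℝ (T.rep i - T.rep k) p} := by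
    ext p
    simp [Fintype.linearCombination_apply, mul_comm]
  rw [this]
  exact convex_iInter₂ fun k _ => convex_iInter fun _ =>
    convex_halfSpace_ge (LinearMap.isLinear _) _

theorem isCompact_U (hI : CoverInvariant X P astar T S) (i : ℕ) : IsCompact (S.U i) := by
  rw [hI.U_eq]
  refine isCompact_region.inter_right ?_
  simp only [Set.ofPred_forall]
  refine isClosed_biInter fun k _ => isClosed_iInter fun _ => ?_
  exact isClosed_le continuous_const (by fun_prop)

/-- The lower bound of `i` reaches the upper bound as soon as it contains its vertices. -/
theorem U_subset_L_of_extremePoints (hI : CoverInvariant X P astar T S) {i : ℕ}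
    (h : (S.U i).extremePoints ℝ ⊆ S.L i) : S.U i ⊆ S.L i := by
  rw [← closure_convexHull_extremePoints (hI.isCompact_U i) (hI.convex_U i)]
  exact closure_minimal (convexHull_min h (hI.convex_L i)) (hI.isCompact_L i).isClosed

theorem extremePoints_U_nonempty (hS : Setting X P astar) (hT : Consistent X P astar T)
    (hI : CoverInvariant X P astar T S) {i : ℕ} (hi : (S.L i).Nonempty) :
    ((S.U i).extremePoints ℝ).Nonempty :=
  (hI.isCompact_U i).extremePoints_nonempty ⟨_, hI.seed_mem_U hS hT hi⟩

/-! ### Preservation of the invariant -/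

theorem mono (hI : CoverInvariant X P astar T S) {T' : Dictionary m} (hD : T'.D = T.D)
    (hrep : T'.rep = T.rep)
    (hA : ∀ e, actionsOf X P astar T e ⊆ actionsOf X P astar T' e) :
    CoverInvariant X P astar T' S where
  mem_D := by rw [hD]; exact hI.mem_D
  seed_mem := hI.seed_mem
  seed_action d hd := hA d (hI.seed_action d hd)
  nonempty_of_mem_C := hI.nonempty_of_mem_C
  hull := hI.hull
  self_mem := hI.self_mem
  nonempty_of_mem_E := hI.nonempty_of_mem_E
  U_eq := by rw [hrep]; exact hI.U_eq
  abs_Δc_sub_le := hI.abs_Δc_sub_le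
  U_subset_L := hI.U_subset_L

theorem tryCover (T : Dictionary m) : CoverInvariant X P astar T (X.tryCover T).S := by
  constructor
  case hull => exact fun d => ⟨∅, Set.finite_empty, by simp [Input.tryCover]⟩
  all_goals simp [Input.tryCover]

theorem erase (hI : CoverInvariant X P astar T S) {i : ℕ} (h : S.U i ⊆ S.L i) :
    CoverInvariant X P astar T { S with C := S.C.erase i } where
  mem_D := hI.mem_D
  seed_mem := hI.seed_mem
  seed_action := hI.seed_action
  nonempty_of_mem_C d hd := hI.nonempty_of_mem_C d (Finset.mem_of_mem_erase hd)
  hull := hI.hull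
  self_mem := hI.self_mem
  nonempty_of_mem_E := hI.nonempty_of_mem_E
  U_eq := hI.U_eq
  abs_Δc_sub_le := hI.abs_Δc_sub_le
  U_subset_L j hj hjC := by
    rcases eq_or_ne j i with rfl | hne
    · exact h
    · exact hI.U_subset_L j hj fun hC => hjC (Finset.mem_erase.2 ⟨hne, hC⟩)

theorem addPoint (hS : Setting X P astar) (hT : Consistent X P astar T)
    (hI : CoverInvariant X P astar T S) {i : ℕ} (hi : (S.L i).Nonempty) {p : Contract m}
    (hp : p ∈ S.U i) {k : ℕ} (hk : k ∈ S.E i) (hpk : astar p ∈ actionsOf X P astar T k) :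
    CoverInvariant X P astar T
      { S with L := Function.update S.L i (convexHull ℝ (S.L i ∪ {p})) } := by
  have hne : ∀ d, (Function.update S.L i (convexHull ℝ (S.L i ∪ {p})) d).Nonempty ↔
      (S.L d).Nonempty := by
    intro d
    rcases eq_or_ne d i with rfl | hne
    · rw [Function.update_self, convexHull_nonempty_iff]
      exact ⟨fun _ => hi, fun h => h.inl⟩
    · rw [Function.update_of_ne hne]
  constructor
  · exact fun d hd => hI.mem_D d ((hne d).1 hd)
  · exact fun d hd => hI.seed_mem d ((hne d).1 hd)
  · exact fun d hd => hI.seed_action d ((hne d).1 hd)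
  · exact fun d hd => (hne d).2 (hI.nonempty_of_mem_C d hd)
  · intro d
    rcases eq_or_ne d i with rfl | hd
    · obtain ⟨K, hfin, hK, hsub⟩ := hI.hull d
      refine ⟨K ∪ {p}, hfin.union (Set.finite_singleton p), ?_, Set.union_subset hsub ?_⟩
      · dsimp only
        rw [Function.update_self, hK, convexHull_convexHull_union_left]
      · rw [Set.singleton_subset_iff]
        exact ⟨hI.U_subset_region d hp, hI.mem_nearBest hS hT hi hp hk hpk⟩
    · dsimp only
      rw [Function.update_of_ne hd]
      exact hI.hull d
  · exact hI.self_mem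
  · intro i' k' hk' hki
    exact ⟨(hne _).2 (hI.nonempty_of_mem_E i' k' hk' hki).1,
      (hne _).2 (hI.nonempty_of_mem_E i' k' hk' hki).2⟩
  · exact hI.U_eq
  · exact hI.abs_Δc_sub_le
  · intro j hj hjC
    have := hI.U_subset_L j ((hne j).1 hj) hjC
    dsimp only
    rcases eq_or_ne j i with rfl | hd
    · rw [Function.update_self]
      exact (this.trans Set.subset_union_left).trans (subset_convexHull ℝ _)
    · rwa [Function.update_of_ne hd]

end CoverInvariant

section discover

variable {T : Dictionary m} {S : Cover m}

theorem discover_E (S : Cover m) (d : ℕ) (p : Contract m) :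
    (Input.discover S d p).E = S.E := by
  unfold Input.discover; split_ifs <;> rfl

theorem discover_U (S : Cover m) (d : ℕ) (p : Contract m) :
    (Input.discover S d p).U = S.U := by
  unfold Input.discover; split_ifs <;> rfl

theorem discover_nonempty (S : Cover m) (d : ℕ) (p : Contract m) :
    ((Input.discover S d p).L d).Nonempty := by
  unfold Input.discover
  split_ifs with h
  · simp
  · exact Set.nonempty_iff_ne_empty.2 h

theorem discover_L_of_nonempty {d : ℕ} {p : Contract m} {e : ℕ} (he : (S.L e).Nonempty) :
    (Input.discover S d p).L e = S.L e ∧ (Input.discover S d p).seed e = S.seed e := by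
  unfold Input.discover
  split_ifs with h
  · have : e ≠ d := by rintro rfl; exact he.ne_empty h
    simp [this]
  · exact ⟨rfl, rfl⟩

theorem mem_discover_C {d : ℕ} {p : Contract m} {e : ℕ} (he : e ∈ S.C) :
    e ∈ (Input.discover S d p).C := by
  unfold Input.discover
  split_ifs with h
  · exact Finset.mem_insert_of_mem he
  · exact he

theorem CoverInvariant.discover (hS : Setting X P astar) (hI : CoverInvariant X P astar T S)
    {d : ℕ} (hd : d ∈ T.D) {p : Contract m} (hp : p ∈ X.region)
    (hpd : astar p ∈ actionsOf X P astar T d) :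
    CoverInvariant X P astar T (Input.discover S d p) := by
  unfold Input.discover
  split_ifs with h
  swap
  · exact hI
  have hd0 : ¬ (S.L d).Nonempty := by rw [h]; exact Set.not_nonempty_empty
  have hL : ∀ e, (Function.update S.L d {p} e).Nonempty → e ≠ d → (S.L e).Nonempty := by
    intro e he hne
    rwa [Function.update_of_ne hne] at he
  have hE : ∀ i, ∀ k ∈ S.E i, k ≠ i → i ≠ d ∧ k ≠ d := by
    intro i k hk hki
    have := hI.nonempty_of_mem_E i k hk hki
    exact ⟨fun h => hd0 (h ▸ this.1), fun h => hd0 (h ▸ this.2)⟩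
  constructor
  · intro e he
    rcases eq_or_ne e d with rfl | hne
    · exact hd
    · exact hI.mem_D e (hL e he hne)
  · intro e he
    dsimp only
    rcases eq_or_ne e d with rfl | hne
    · rwa [Function.update_self]
    · rw [Function.update_of_ne hne]
      exact hI.seed_mem e (hL e he hne)
  · intro e he
    dsimp only
    rcases eq_or_ne e d with rfl | hne
    · rwa [Function.update_self]
    · rw [Function.update_of_ne hne]
      exact hI.seed_action e (hL e he hne)
  · intro e he
    dsimp only
    rcases eq_or_ne e d with rfl | hne
    · rw [Function.update_self]; exact Set.singleton_nonempty p
    · rw [Function.update_of_ne hne]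
      exact hI.nonempty_of_mem_C e ((Finset.mem_insert.1 he).resolve_left hne)
  · intro e
    dsimp only
    rcases eq_or_ne e d with rfl | hne
    · rw [Function.update_self, Function.update_self]
      refine ⟨{p}, Set.finite_singleton p, (convexHull_singleton p).symm, ?_⟩
      rw [Set.singleton_subset_iff]
      refine ⟨hp, fun b => ?_⟩
      have := (hS.response p hp.1).1 b
      have := hS.regret_nonneg
      linarith
    · rw [Function.update_of_ne hne, Function.update_of_ne hne]
      exact hI.hull e
  · exact hI.self_mem
  · intro i k hk hki
    obtain ⟨h1, h2⟩ := hE i k hk hki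
    dsimp only
    rw [Function.update_of_ne h1, Function.update_of_ne h2]
    exact hI.nonempty_of_mem_E i k hk hki
  · exact hI.U_eq
  · intro i k hk hki
    obtain ⟨h1, h2⟩ := hE i k hk hki
    dsimp only
    rw [Function.update_of_ne h1, Function.update_of_ne h2]
    exact hI.abs_Δc_sub_le i k hk hki
  · intro j hj hjC
    have hne : j ≠ d := fun h => hjC (Finset.mem_insert.2 (Or.inl h))
    dsimp only
    rw [Function.update_of_ne hne]
    exact hI.U_subset_L j (hL j hj hne) fun h => hjC (Finset.mem_insert_of_mem h)

end discover

/-! ### The approximate halfspaces -/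

theorem mid_mem_region {p p' : Contract m} (hp : p ∈ X.region) (hp' : p' ∈ X.region) :
    mid p p' ∈ X.region := by
  have : mid p p' = (1 / 2 : ℝ) • p + (1 / 2 : ℝ) • p' := by
    ext ω; simp [mid]; ring
  rw [this]
  exact convex_region hp hp' (by norm_num) (by norm_num) (by norm_num)

/-- Between two contracts at distance at most `η`, the difference of the expected payments of the
actions played under them is close to the difference of their costs. -/
theorem Setting.abs_sum_mid_sub_le (hS : Setting X P astar) {p₁ p₂ : Contract m}
    (hp₁ : p₁ ∈ X.region) (hp₂ : p₂ ∈ X.region) (hd : dist₂ p₁ p₂ ≤ X.η) :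
    |∑ ω, (P.F (astar p₁) ω - P.F (astar p₂) ω) * mid p₁ p₂ ω
      - (P.c (astar p₁) - P.c (astar p₂))| ≤ √(m : ℝ) * X.η / 2 := by
  set f : Fin m → ℝ := fun ω => P.F (astar p₁) ω - P.F (astar p₂) ω with hf
  have h1 := hS.cost_sub_le hp₁ (astar p₂)
  have h2 := hS.cost_sub_le hp₂ (astar p₁)
  have hF : ∀ a ω, P.F a ω ≤ 1 := fun a ω => by
    rw [← P.F_sum a]
    exact Finset.single_le_sum (fun ω _ => P.F_nonneg a ω) (Finset.mem_univ ω)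
  have hf1 : ∑ ω, f ω ^ 2 ≤ m := by
    calc ∑ ω, f ω ^ 2 ≤ ∑ _ω : Fin m, (1 : ℝ) := by
          refine Finset.sum_le_sum fun ω _ => ?_
          rw [sq_le_one_iff_abs_le_one, abs_le]
          have := hF (astar p₁) ω
          have := hF (astar p₂) ω
          have := P.F_nonneg (astar p₁) ω
          have := P.F_nonneg (astar p₂) ω
          constructor <;> simp only [hf] <;> linarith
      _ = m := by simp
  have hCS : |∑ ω, f ω * (p₁ ω - p₂ ω)| ≤ √(m : ℝ) * X.η := by
    calc |∑ ω, f ω * (p₁ ω - p₂ ω)| ≤ √((∑ ω, f ω ^ 2) * ∑ ω, (p₁ ω - p₂ ω) ^ 2) :=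
          Real.abs_le_sqrt (Finset.sum_mul_sq_le_sq_mul_sq _ _ _)
      _ = √(∑ ω, f ω ^ 2) * dist₂ p₁ p₂ := by
          rw [Real.sqrt_mul (Finset.sum_nonneg fun _ _ => sq_nonneg _)]; rfl
      _ ≤ √(m : ℝ) * X.η :=
          mul_le_mul (Real.sqrt_le_sqrt hf1) hd (Real.sqrt_nonneg _) (Real.sqrt_nonneg _)
  have e1 : ∑ ω, f ω * mid p₁ p₂ ω
      = ∑ ω, f ω * p₁ ω - (∑ ω, f ω * (p₁ ω - p₂ ω)) / 2 := by
    rw [Finset.sum_div, ← Finset.sum_sub_distrib]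
    refine Finset.sum_congr rfl fun ω _ => ?_
    simp only [mid]; ring
  have e2 : ∑ ω, f ω * (p₁ ω - p₂ ω) = ∑ ω, f ω * p₁ ω - ∑ ω, f ω * p₂ ω := by
    rw [← Finset.sum_sub_distrib]
    exact Finset.sum_congr rfl fun ω _ => by ring
  have h2' : ∑ ω, f ω * p₂ ω ≤ P.c (astar p₁) - P.c (astar p₂) := by
    have : ∑ ω, (P.F (astar p₂) ω - P.F (astar p₁) ω) * p₂ ω = -∑ ω, f ω * p₂ ω := by
      rw [← Finset.sum_neg_distrib]
      exact Finset.sum_congr rfl fun ω _ => by simp only [hf]; ring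
    linarith
  rw [e1]
  obtain ⟨h3, h4⟩ := abs_le.1 hCS
  rw [abs_le]
  constructor <;> linarith

/-- Cutting the upper bound of `i` preserves the invariant: every cut increases the error of the
estimated cost differences by at most `X.stepError`. -/
theorem CoverInvariant.cut (hS : Setting X P astar) {T : Dictionary m} {S : Cover m}
    (hT : Consistent X P astar T) (hI : CoverInvariant X P astar T S) {i j k : ℕ} (hiC : i ∈ S.C)
    (hj : j ∈ S.E i) (hk : k ∉ S.E i) (hkL : (S.L k).Nonempty) {p₁ p₂ : Contract m}
    (hp₁ : p₁ ∈ X.region) (hp₂ : p₂ ∈ X.region) (hj₁ : astar p₁ ∈ actionsOf X P astar T j)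
    (hk₂ : astar p₂ ∈ actionsOf X P astar T k) (hd : dist₂ p₁ p₂ ≤ X.η) :
    CoverInvariant X P astar T (X.cut T S i p₁ p₂ j k) := by
  have hi := hI.nonempty_of_mem_C i hiC
  have hjL := hI.nonempty_L_of_mem_E hi hj
  have hki : k ≠ i := fun h => hk (h ▸ hI.self_mem i)
  have hmid := mid_mem_region hp₁ hp₂
  set e : ℝ := ∑ ω, (T.rep j ω - T.rep k ω) * mid p₁ p₂ ω with he
  set Δ : ℝ := if j = i then e else S.Δc i j + e with hΔ
  have he_err : |e - (P.c (astar (S.seed j)) - P.c (astar (S.seed k)))| ≤ X.stepError := by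
    have h1 := abs_le.1 (hS.abs_sum_mid_sub_le hp₁ hp₂ hd)
    have h2 := abs_le.1 (hT.abs_sum_rep_sub_le hS (hI.mem_D j hjL) hj₁ hmid)
    have h3 := abs_le.1 (hT.abs_sum_rep_sub_le hS (hI.mem_D k hkL) hk₂ hmid)
    have h4 := abs_le.1 (hT.abs_cost_sub_le hS (hI.mem_D j hjL) hj₁ (hI.seed_action j hjL))
    have h5 := abs_le.1 (hT.abs_cost_sub_le hS (hI.mem_D k hkL) hk₂ (hI.seed_action k hkL))
    simp only [sub_mul, Finset.sum_sub_distrib] at h1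
    rw [he]
    simp only [sub_mul, Finset.sum_sub_distrib, Input.stepError]
    rw [abs_le]
    constructor <;> linarith [h1.1, h1.2, h2.1, h2.2, h3.1, h3.2, h4.1, h4.2, h5.1, h5.2]
  have hcard1 : (1 : ℝ) ≤ (S.E i).card := by
    exact_mod_cast Finset.card_pos.2 ⟨i, hI.self_mem i⟩
  have hstep := hS.stepError_nonneg
  have hΔ_err : |Δ - (P.c (astar (S.seed i)) - P.c (astar (S.seed k)))|
      ≤ (S.E i).card * X.stepError := by
    rw [hΔ]
    split_ifs with hji
    · subst hji
      refine he_err.trans ?_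
      nlinarith
    · have h1 := abs_le.1 (hI.abs_Δc_sub_le i j hj hji)
      have h2 := abs_le.1 he_err
      rw [abs_le]
      constructor <;> linarith [h1.1, h1.2, h2.1, h2.2]
  have hcut : X.cut T S i p₁ p₂ j k =
      { S with
        Δc := Function.update S.Δc i (Function.update (S.Δc i) k Δ)
        U := Function.update S.U i (S.U i ∩ {p | (∀ ω, 0 ≤ p ω) ∧
          Δ - X.y ≤ ∑ ω, (T.rep i ω - T.rep k ω) * p ω})
        E := Function.update S.E i (insert k (S.E i)) } := rfl
  rw [hcut]
  have hE : ∀ i', Function.update S.E i (insert k (S.E i)) i'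
      = if i' = i then insert k (S.E i) else S.E i' := fun i' => by
    by_cases h : i' = i
    · subst h; simp
    · simp [h]
  constructor
  · exact hI.mem_D
  · exact hI.seed_mem
  · exact hI.seed_action
  · exact hI.nonempty_of_mem_C
  · exact hI.hull
  · intro i'
    dsimp only
    rw [hE]
    split_ifs with h
    · subst h; exact Finset.mem_insert_of_mem (hI.self_mem i')
    · exact hI.self_mem i'
  · intro i' k' hk' hne
    dsimp only at hk' ⊢
    rw [hE] at hk'
    split_ifs at hk' with h
    · subst h
      rcases Finset.mem_insert.1 hk' with rfl | hk'
      · exact ⟨hi, hkL⟩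
      · exact hI.nonempty_of_mem_E i' k' hk' hne
    · exact hI.nonempty_of_mem_E i' k' hk' hne
  · intro i'
    dsimp only
    rw [hE]
    by_cases h : i' = i
    · subst h
      rw [Function.update_self, Function.update_self, if_pos rfl, hI.U_eq]
      ext p
      simp only [Set.mem_inter_iff, Set.mem_ofPred_eq, Finset.forall_mem_insert]
      have e1 : ∀ k' ∈ S.E i', Function.update (S.Δc i') k Δ k' = S.Δc i' k' := fun k' hk' =>
        Function.update_of_ne (by rintro rfl; exact hk hk') _ _
      rw [Function.update_self]
      constructor
      · rintro ⟨⟨h1, h2⟩, -, h3⟩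
        exact ⟨h1, fun _ => h3, fun k' hk' hne => by rw [e1 k' hk']; exact h2 k' hk' hne⟩
      · rintro ⟨h1, h2, h3⟩
        exact ⟨⟨h1, fun k' hk' hne => by rw [← e1 k' hk']; exact h3 k' hk' hne⟩, h1.1, h2 hki⟩
    · rw [Function.update_of_ne h, Function.update_of_ne h, if_neg h]
      exact hI.U_eq i'
  · intro i' k' hk' hne
    dsimp only at hk' ⊢
    rw [hE] at hk' ⊢
    split_ifs at hk' ⊢ with h
    · subst h
      rw [Function.update_self, Finset.card_insert_of_notMem hk]
      push_cast
      rw [add_sub_cancel_right]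
      rcases Finset.mem_insert.1 hk' with rfl | hkE
      · rw [Function.update_self]; exact hΔ_err
      · rw [Function.update_of_ne (by rintro rfl; exact hk hkE)]
        refine (hI.abs_Δc_sub_le i' k' hkE hne).trans ?_
        nlinarith
    · rw [Function.update_of_ne h]
      exact hI.abs_Δc_sub_le i' k' hk' hne
  · intro i' hi' hi'C
    have h : i' ≠ i := fun h => hi'C (h ▸ hiC)
    dsimp only
    rw [Function.update_of_ne h]
    exact hI.U_subset_L i' hi' hi'C

/-! ### Optimality of the returned contract -/

theorem isCompact_boundedContracts (m : ℕ) (B : ℝ) : IsCompact (boundedContracts m B) := by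
  have : boundedContracts m B = Set.pi Set.univ fun _ => Set.Icc 0 B := by
    ext p; simp only [boundedContracts, Set.mem_ofPred_eq, Set.mem_univ_pi]
  rw [this]
  exact isCompact_univ_pi fun _ => isCompact_Icc

theorem Setting.zero_mem_boundedContracts (hS : Setting X P astar) :
    (0 : Contract m) ∈ boundedContracts m X.B := fun _ =>
  ⟨le_rfl, zero_le_one.trans hS.one_le_B⟩

/-- As ties are broken in favour of the principal, her utility attains its maximum on
`[0, B] ^ m`. -/
theorem Setting.exists_isGreatest (hS : Setting X P astar) :
    ∃ M, IsGreatest (P.u astar '' boundedContracts m X.B) M := by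
  classical
  let K : Fin X.n → Set (Contract m) := fun a =>
    boundedContracts m X.B ∩ {p | a ∈ P.bestResponses p}
  have hKc : ∀ a, IsCompact (K a) := fun a => by
    refine (isCompact_boundedContracts m X.B).inter_right ?_
    have : {p | a ∈ P.bestResponses p}
        = ⋂ b, {p | P.agentUtility p b ≤ P.agentUtility p a} := by
      ext p; simp [PrincipalAgent.bestResponses]
    rw [this]
    unfold PrincipalAgent.agentUtility
    exact isClosed_iInter fun b => isClosed_le (by fun_prop) (by fun_prop)
  have hmax : ∀ a, (K a).Nonempty → ∃ p ∈ K a, ∀ p' ∈ K a,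
      P.principalUtility p' a ≤ P.principalUtility p a := fun a ha => by
    obtain ⟨p, hp, hmax⟩ := (hKc a).exists_isMaxOn ha
      (f := fun p => P.principalUtility p a) (by
        unfold PrincipalAgent.principalUtility
        fun_prop)
    exact ⟨p, hp, hmax⟩
  choose! v hv hvmax using hmax
  have hmem : ∀ p ∈ boundedContracts m X.B, p ∈ K (astar p) := fun p hp =>
    ⟨hp, (hS.response p fun ω => (hp ω).1).1⟩
  obtain ⟨a, ha, hamax⟩ := Finset.exists_max_image (Finset.univ.filter fun a => (K a).Nonempty)
    (fun a => P.principalUtility (v a) a)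
    ⟨astar 0, by simpa using ⟨0, hmem 0 hS.zero_mem_boundedContracts⟩⟩
  have haK := hv a (by simpa using ha)
  refine ⟨P.u astar (v a), ⟨v a, haK.1, rfl⟩, ?_⟩
  rintro _ ⟨p, hp, rfl⟩
  have hpK := hmem p hp
  calc P.u astar p ≤ P.principalUtility (v (astar p)) (astar p) :=
        hvmax (astar p) ⟨p, hpK⟩ p hpK
    _ ≤ P.principalUtility (v a) a := hamax _ (by simpa using ⟨p, hpK⟩)
    _ ≤ P.u astar (v a) := (hS.response (v a) fun ω => (haK.1 ω).1).2 a haK.2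

/-- When `Try-Cover` succeeds, the lower bounds cover the region: the upper bound of a meta-action
with the best representative action at `p` contains `p`. -/
theorem CoverInvariant.exists_mem_L (hS : Setting X P astar) {T : Dictionary m} {S : Cover m}
    (hT : Consistent X P astar T) (hI : CoverInvariant X P astar T S) (hC : S.C = ∅)
    (hL : ∃ d, (S.L d).Nonempty) {p : Contract m} (hp : p ∈ X.region) :
    ∃ i, (S.L i).Nonempty ∧ p ∈ S.L i := by
  classical
  obtain ⟨d, hd⟩ := hL
  obtain ⟨i, hi, hmax⟩ := Finset.exists_max_image (T.D.filter fun d => (S.L d).Nonempty)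
    (fun d => P.agentUtility p (astar (S.seed d)))
    ⟨d, Finset.mem_filter.2 ⟨hI.mem_D d hd, hd⟩⟩
  have hi' := (Finset.mem_filter.1 hi).2
  exact ⟨i, hi', hI.U_subset_L i hi' (by simp [hC]) (hI.mem_U hS hT hi' hp fun k hk =>
    hmax k (Finset.mem_filter.2 ⟨hI.mem_D k hk, hk⟩))⟩

theorem maximizers_nonempty (hS : Setting X P astar) {T : Dictionary m} {S : Cover m}
    (hT : Consistent X P astar T) (hI : CoverInvariant X P astar T S) (hC : S.C = ∅)
    (hL : ∃ d, (S.L d).Nonempty) : (X.maximizers T S).Nonempty := by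
  classical
  have hmax : ∀ d, (S.L d ∩ boundedContracts m X.B).Nonempty →
      ∃ p ∈ S.L d ∩ boundedContracts m X.B, ∀ p' ∈ S.L d ∩ boundedContracts m X.B,
        X.value T d p' ≤ X.value T d p := fun d hd => by
    obtain ⟨p, hp, hmax⟩ := ((hI.isCompact_L d).inter
      (isCompact_boundedContracts m X.B)).exists_isMaxOn hd (f := X.value T d) (by
        unfold Input.value
        fun_prop)
    exact ⟨p, hp, hmax⟩
  choose! v hv hvmax using hmax
  obtain ⟨i, hi, h0i⟩ := hI.exists_mem_L hS hT hC hL (zero_mem_region hS)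
  obtain ⟨d, hd, hdmax⟩ := Finset.exists_max_image
    (T.D.filter fun d => (S.L d ∩ boundedContracts m X.B).Nonempty)
    (fun d => X.value T d (v d))
    ⟨i, Finset.mem_filter.2 ⟨hI.mem_D i hi, 0, h0i, hS.zero_mem_boundedContracts⟩⟩
  obtain ⟨hdD, hdn⟩ := Finset.mem_filter.1 hd
  refine ⟨v d, d, hdD, hv d hdn, fun d' hd' p' hp' => ?_⟩
  exact (hvmax d' ⟨p', hp'⟩ p' hp').trans (hdmax d' (Finset.mem_filter.2 ⟨hd', p', hp'⟩))

/-- The contract `p` moved towards the rewards. -/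
def towardsRewards (r : Fin m → ℝ) (s : ℝ) (p : Contract m) : Contract m :=
  fun ω => (1 - s) * p ω + s * r ω

theorem towardsRewards_mem (hS : Setting X P astar) {s : ℝ} (hs : s ∈ Set.Icc (0 : ℝ) 1)
    {p : Contract m} (hp : p ∈ boundedContracts m X.B) :
    towardsRewards P.r s p ∈ boundedContracts m X.B := by
  intro ω
  have h1 := hp ω
  have h2 := P.r_mem ω
  have h3 := hS.one_le_B
  have h4 : P.r ω ∈ Set.Icc 0 X.B := ⟨h2.1, h2.2.trans h3⟩
  exact (convex_Icc 0 X.B) h1 h4 (sub_nonneg.2 hs.2) hs.1 (by ring)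

theorem agentUtility_towardsRewards (s : ℝ) (p : Contract m) (a : Fin X.n) :
    P.agentUtility (towardsRewards P.r s p) a
      = P.agentUtility p a + s * P.principalUtility p a := by
  simp only [PrincipalAgent.agentUtility, PrincipalAgent.principalUtility, towardsRewards,
    Finset.mul_sum]
  have : ∑ ω, P.F a ω * ((1 - s) * p ω + s * P.r ω)
      = ∑ ω, P.F a ω * p ω + ∑ ω, s * (P.F a ω * (P.r ω - p ω)) := by
    rw [← Finset.sum_add_distrib]
    exact Finset.sum_congr rfl fun ω _ => by ring
  rw [this]
  ring

theorem principalUtility_le_one {p : Contract m} (hp : ∀ ω, 0 ≤ p ω) (a : Fin X.n) :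
    P.principalUtility p a ≤ 1 := by
  rw [← P.F_sum a]
  refine Finset.sum_le_sum fun ω _ => ?_
  have := (P.r_mem ω).2
  exact mul_le_of_le_one_right (P.F_nonneg a ω) (by linarith [hp ω])

theorem principalUtility_sub_le {s : ℝ} (hs : 0 ≤ s) {p : Contract m} (hp : ∀ ω, 0 ≤ p ω)
    (a : Fin X.n) :
    P.principalUtility p a - s ≤ P.principalUtility (towardsRewards P.r s p) a := by
  have : P.principalUtility (towardsRewards P.r s p) a = (1 - s) * P.principalUtility p a := by
    simp only [PrincipalAgent.principalUtility, towardsRewards, Finset.mul_sum]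
    exact Finset.sum_congr rfl fun ω _ => by ring
  have h1 := mul_le_mul_of_nonneg_left (principalUtility_le_one (P := P) hp a) hs
  rw [this]
  linarith

theorem abs_value_sub_le (hS : Setting X P astar) {T : Dictionary m} (hT : Consistent X P astar T)
    {d : ℕ} (hd : d ∈ T.D) {a : Fin X.n} (ha : a ∈ actionsOf X P astar T d) {p : Contract m}
    (hp : p ∈ boundedContracts m X.B) :
    |X.value T d p - P.principalUtility p a| ≤ X.swapError := by
  have h1 := hS.one_le_B
  have h2 : X.value T d p - P.principalUtility p a
      = ∑ ω, (T.rep d - P.F a) ω * (P.r ω - p ω) := by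
    simp only [Input.value, PrincipalAgent.principalUtility, hS.r_eq, Pi.sub_apply, sub_mul,
      Finset.sum_sub_distrib]
  rw [h2]
  calc |∑ ω, (T.rep d - P.F a) ω * (P.r ω - p ω)|
      ≤ ∑ ω, |(T.rep d - P.F a) ω * (P.r ω - p ω)| := Finset.abs_sum_le_sum_abs _ _
    _ ≤ ∑ _ω : Fin m, 4 * X.ε * X.n * X.B := by
        refine Finset.sum_le_sum fun ω _ => ?_
        rw [abs_mul]
        have h3 := (norm_le_pi_norm (T.rep d - P.F a) ω).trans (hT.norm_rep_sub_le hS hd ha)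
        have h4 : |P.r ω - p ω| ≤ X.B := by
          rw [abs_le]
          constructor <;> linarith [(hp ω).1, (hp ω).2, (P.r_mem ω).1, (P.r_mem ω).2]
        exact mul_le_mul h3 h4 (abs_nonneg _) ((norm_nonneg _).trans (hT.norm_rep_sub_le hS hd ha))
    _ = X.swapError := by
        rw [Finset.sum_const, Finset.card_univ, Fintype.card_fin, nsmul_eq_mul]
        unfold Input.swapError
        ring

theorem Setting.B_mul_ε (hS : Setting X P astar) :
    X.B * X.ε * m * (X.n : ℝ) ^ 2 ≤ X.ρ ^ 2 / 1024 := by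
  have h1 := hS.one_le_n
  have h2 := hS.one_le_m
  have h3 := hS.one_le_B
  have : X.B * X.ε * m * (X.n : ℝ) ^ 2 = X.ρ ^ 2 / 1024 / m := by
    unfold Input.ε
    field_simp
    ring
  rw [this]
  exact div_le_self (by positivity) h2

theorem Setting.γ_pos (hS : Setting X P astar) : 0 < X.γ := by
  have h1 := hS.one_le_n
  have h2 := hS.one_le_m
  have h3 := hS.one_le_B
  have h4 := hS.ε_pos
  have h5 := hS.η_pos
  unfold Input.γ
  positivity

theorem Setting.sqrt_γ_le (hS : Setting X P astar) : √X.γ ≤ 0.1654 * X.ρ := by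
  have h1 := hS.one_le_n
  have h2 := hS.one_le_m
  have h3 := hS.one_le_B
  have h4 := hS.ε_pos
  have h5 := hS.B_mul_ε
  have h6 := hS.ρ_mem.1
  have h7 : 2 * X.n * X.η * √(m : ℝ) = X.ε * m * (X.n : ℝ) ^ 2 := by
    have := Real.mul_self_sqrt (Nat.cast_nonneg (α := ℝ) m)
    unfold Input.η
    linear_combination X.ε * (X.n : ℝ) ^ 2 * this
  have h8 : X.ε * m * (X.n : ℝ) ^ 2 ≤ X.B * X.ε * m * (X.n : ℝ) ^ 2 := by
    have : 0 ≤ X.ε * m * (X.n : ℝ) ^ 2 := by positivity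
    nlinarith
  rw [Real.sqrt_le_iff]
  refine ⟨by positivity, ?_⟩
  unfold Input.γ
  rw [h7]
  nlinarith

theorem Setting.swapError_le (hS : Setting X P astar) : X.swapError ≤ 4 / 1024 * X.ρ := by
  have h1 := hS.one_le_n
  have h2 := hS.one_le_m
  have h3 := hS.one_le_B
  have h4 := hS.ε_pos
  have h5 := hS.B_mul_ε
  have h6 := hS.ρ_mem
  have h7 : X.B * X.ε * m * X.n ≤ X.B * X.ε * m * (X.n : ℝ) ^ 2 := by
    refine mul_le_mul_of_nonneg_left ?_ (by positivity)
    nlinarith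
  have h8 : X.ρ ^ 2 ≤ X.ρ := by nlinarith [h6.1, h6.2]
  unfold Input.swapError
  linarith

/-- If the lower bounds cover the region, then `Find-Contract` is `ρ`-optimal: by moving a contract
towards the rewards, the agent is made to play an action that is almost as good for the principal
as any action that is almost optimal for the agent. -/
theorem isApproxOptimal_findContract (hS : Setting X P astar) {T : Dictionary m} {S : Cover m}
    (hT : Consistent X P astar T) (hI : CoverInvariant X P astar T S) (hC : S.C = ∅)
    (hL : ∃ d, (S.L d).Nonempty) :
    P.IsApproxOptimal astar X.B X.ρ (X.findContract T S).point := by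
  have hγ := hS.γ_pos
  have hs0 : 0 < √X.γ := Real.sqrt_pos.2 hγ
  have hsρ := hS.sqrt_γ_le
  have hρ := hS.ρ_mem
  have hss : √X.γ * √X.γ = X.γ := Real.mul_self_sqrt hγ.le
  have hR := hS.regret_le
  have hκ := hS.swapError_le
  have hpt : (X.findContract T S).point
      = towardsRewards P.r (√X.γ) (X.sel.contract (X.maximizers T S)) := by
    funext ω
    simp [Input.findContract, towardsRewards, hS.r_eq]
  have hmem := X.sel.contract_mem _ (maximizers_nonempty hS hT hI hC hL)
  rw [hpt]
  set s := √X.γ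
  set p := X.sel.contract (X.maximizers T S)
  have hs : s ∈ Set.Icc (0 : ℝ) 1 := ⟨hs0.le, by linarith [hρ.2]⟩
  obtain ⟨d, hd, ⟨hpL, hpB⟩, hopt⟩ := hmem
  have hpout := towardsRewards_mem hS hs hpB
  obtain ⟨M, hM⟩ := hS.exists_isGreatest
  refine ⟨hpout, M, hM, ?_⟩
  obtain ⟨p₀, hp₀B, hp₀⟩ := hM.1
  -- the optimal contract, moved towards the rewards, lies in some lower bound
  have hp₁B := towardsRewards_mem hS hs hp₀B
  obtain ⟨i, hi, hp₁L⟩ := hI.exists_mem_L hS hT hC hL (boundedContracts_subset_region hp₁B)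
  set a := astar (S.seed i)
  set b := astar (S.seed d)
  have e1 : s * P.principalUtility p₀ (astar p₀)
      ≤ s * P.principalUtility p₀ a + X.regret := by
    have h1 := (hI.L_subset i hp₁L).2 (astar p₀)
    have h2 := (hS.response p₀ fun ω => (hp₀B ω).1).1 a
    rw [agentUtility_towardsRewards, agentUtility_towardsRewards] at h1
    linarith
  have e2 := principalUtility_sub_le (P := P) hs0.le (fun ω => (hp₀B ω).1) a
  have e3 := (abs_le.1 (abs_value_sub_le hS hT (hI.mem_D i hi) (hI.seed_action i hi) hp₁B)).1
  have e4 := hopt i (hI.mem_D i hi) _ ⟨hp₁L, hp₁B⟩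
  have e5 := (abs_le.1 (abs_value_sub_le hS hT hd (hI.seed_action d ⟨p, hpL⟩) hpB)).2
  have e6 : s * P.principalUtility p b
      ≤ s * P.principalUtility p (astar (towardsRewards P.r s p)) + X.regret := by
    have h1 := (hI.L_subset d hpL).2 (astar (towardsRewards P.r s p))
    have h2 := (hS.response _ fun ω => (hpout ω).1).1 b
    rw [agentUtility_towardsRewards, agentUtility_towardsRewards] at h2
    linarith
  have e7 := principalUtility_sub_le (P := P) hs0.le (fun ω => (hpB ω).1)
    (astar (towardsRewards P.r s p))
  have key : ∀ x y : ℝ, s * x ≤ s * y + X.regret → x ≤ y + 3 / 2 * s := by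
    intro x y hxy
    refine le_of_mul_le_mul_left ?_ hs0
    linarith
  have e1' := key _ _ e1
  have e6' := key _ _ e6
  have hu₀ : P.principalUtility p₀ (astar p₀) = M := hp₀
  unfold PrincipalAgent.u
  linarith

/-! ### The number of calls of `Action-Oracle` -/

namespace Input

variable {m : ℕ} (X : Input m)

/-- A bound on the number of halvings in a binary search. -/
def searchSteps : ℕ := ⌈Real.logb 2 (2 * X.B * m / X.η)⌉₊

/-- A bound on the number of calls of `Action-Oracle` in a pass and the call of `Find-HS` that ends
it. -/
def passCost : ℕ := (m + X.n + 1).choose m + 2 + X.searchSteps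

end Input

open Classical in
/-- The meta-actions that are not known to have been processed. -/
def undone (T : Dictionary m) (S : Cover m) : Finset ℕ :=
  T.D.filter fun d => S.L d = ∅ ∨ d ∈ S.C

/-- A bound on the number of calls of `Action-Oracle` until the meta-actions other than `i` have been
processed. -/
def otherCalls (X : Input m) (T : Dictionary m) (S : Cover m) (i : ℕ) : ℕ :=
  ((undone T S).erase i).card * (T.D.card * X.passCost)

/-- The invariant of the control points of `Try-Cover` and `Find-HS`, where `N` is a bound on the
number of calls of `Action-Oracle` until the end of the current run of `Try-Cover`, including the
pending one. Each cut for `i` adds an element of `T.D` to `S.E i`, so that at most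
`T.D.card - (S.E i).card` cuts remain. -/
def PhaseInvariant (X : Input m) (P : PrincipalAgent X.n m) (astar : Contract m → Fin X.n)
    (T : Dictionary m) (S : Cover m) (point : Contract m) (phase : Phase m) (N : ℕ) : Prop :=
  match phase with
  | Phase.first =>
    point ∈ X.region ∧ (∀ d, S.L d = ∅) ∧ 1 + T.D.card * (T.D.card * X.passCost) ≤ N
  | Phase.vertex i V =>
    i ∈ S.C ∧ point ∈ (S.U i).extremePoints ℝ ∧ V ⊆ (S.U i).extremePoints ℝ ∧
      (∀ p ∈ (S.U i).extremePoints ℝ, p = point ∨ p ∈ V ∨ p ∈ S.L i) ∧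
      V.ncard + 1 + (T.D.card - (S.E i).card) * X.passCost + otherCalls X T S i ≤ N
  | Phase.left i p =>
    i ∈ S.C ∧ point = S.seed i ∧ p ∈ X.region ∧
      (∃ k, k ∉ S.E i ∧ (S.L k).Nonempty ∧ astar p ∈ actionsOf X P astar T k) ∧
      (T.D.card - (S.E i).card) * X.passCost + otherCalls X T S i ≤ N
  | Phase.right i j =>
    i ∈ S.C ∧ j = i ∧ point ∈ X.region ∧
      (∃ k, k ∉ S.E i ∧ (S.L k).Nonempty ∧ astar point ∈ actionsOf X P astar T k) ∧
      (T.D.card - (S.E i).card) * X.passCost + otherCalls X T S i ≤ N + 1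
  | Phase.middle i p₁ p₂ j k =>
    i ∈ S.C ∧ point = mid p₁ p₂ ∧ p₁ ∈ X.region ∧ p₂ ∈ X.region ∧
      j ∈ S.E i ∧ astar p₁ ∈ actionsOf X P astar T j ∧
      k ∉ S.E i ∧ (S.L k).Nonempty ∧ astar p₂ ∈ actionsOf X P astar T k ∧ X.η < dist₂ p₁ p₂ ∧
      ∃ ℓ : ℕ, dist₂ p₁ p₂ ≤ X.η * 2 ^ ℓ ∧
        (m + X.n + 1).choose m + (T.D.card - (S.E i).card - 1) * X.passCost + otherCalls X T S i + ℓ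
          ≤ N
  | Phase.halted => P.IsApproxOptimal astar X.B X.ρ point

/-- The invariant of the algorithm between two calls of `Action-Oracle`. -/
structure RunInvariant (X : Input m) (P : PrincipalAgent X.n m) (astar : Contract m → Fin X.n)
    (s : Control m) (N : ℕ) : Prop where
  consistent : Consistent X P astar s.T
  cover : CoverInvariant X P astar s.T s.S
  phase : PhaseInvariant X P astar s.T s.S s.point s.phase N

theorem mem_undone {T : Dictionary m} {S : Cover m} {d : ℕ} :
    d ∈ undone T S ↔ d ∈ T.D ∧ (S.L d = ∅ ∨ d ∈ S.C) := by
  simp [undone]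

theorem card_undone_le (T : Dictionary m) (S : Cover m) : (undone T S).card ≤ T.D.card := by
  classical
  exact Finset.card_filter_le _ _

theorem undone_discover (T : Dictionary m) (S : Cover m) (d : ℕ) (p : Contract m) :
    undone T (Input.discover S d p) = undone T S := by
  unfold Input.discover
  split_ifs with h
  · ext e
    rw [mem_undone, mem_undone]
    refine and_congr_right fun _ => ?_
    rcases eq_or_ne e d with rfl | hne
    · simp [h]
    · simp [hne]
  · rfl

theorem CoverInvariant.card_E_lt {T : Dictionary m} {S : Cover m}
    (hI : CoverInvariant X P astar T S) {i k : ℕ} (hi : i ∈ S.C) (hk : k ∉ S.E i)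
    (hkL : (S.L k).Nonempty) : (S.E i).card < T.D.card := by
  have h := Finset.card_le_card (Finset.insert_subset (hI.mem_D k hkL)
    (hI.E_subset (hI.nonempty_of_mem_C i hi)))
  rw [Finset.card_insert_of_notMem hk] at h
  exact h

theorem RunInvariant.nextVertex {T : Dictionary m} {S : Cover m} (hT : Consistent X P astar T)
    (hI : CoverInvariant X P astar T S) {i : ℕ} (hi : i ∈ S.C) {V : Set (Contract m)}
    (hV : V ⊆ (S.U i).extremePoints ℝ) (hne : V.Nonempty)
    (hL : ∀ p ∈ (S.U i).extremePoints ℝ, p ∈ V ∨ p ∈ S.L i) {N : ℕ}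
    (hN : V.ncard + (T.D.card - (S.E i).card) * X.passCost + otherCalls X T S i ≤ N) :
    RunInvariant X P astar (X.nextVertex T S i V) N := by
  have hmem := X.sel.contract_mem V hne
  have hfin : V.Finite := (hI.extremePoints_U hT (hI.nonempty_of_mem_C i hi)).1.subset hV
  have hcard := Set.ncard_sdiff_singleton_add_one hmem hfin
  refine ⟨hT, hI, hi, hV hmem, Set.sdiff_subset.trans hV, fun p hp => ?_, ?_⟩
  · rcases hL p hp with h | h
    · by_cases hp' : p = X.sel.contract V
      · exact Or.inl hp'
      · exact Or.inr (Or.inl ⟨h, hp'⟩)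
    · exact Or.inr (Or.inr h)
  · change (V \ {X.sel.contract V}).ncard + 1 + (T.D.card - (S.E i).card) * X.passCost
      + otherCalls X T S i ≤ N
    rw [hcard]
    exact hN

theorem RunInvariant.startPass (hS : Setting X P astar) {T : Dictionary m} {S : Cover m}
    (hT : Consistent X P astar T) (hI : CoverInvariant X P astar T S) {i : ℕ} (hi : i ∈ S.C) {N : ℕ}
    (hN : (m + X.n + 1).choose m + (T.D.card - (S.E i).card) * X.passCost + otherCalls X T S i
      ≤ N) :
    RunInvariant X P astar (X.startPass T S i) N := by
  have hiL := hI.nonempty_of_mem_C i hi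
  have := (hI.extremePoints_U hT hiL).2
  exact RunInvariant.nextVertex hT hI hi subset_rfl (hI.extremePoints_U_nonempty hS hT hiL)
    (fun p hp => Or.inl hp) (by omega)

theorem RunInvariant.nextMetaAction (hS : Setting X P astar) {T : Dictionary m} {S : Cover m}
    (hT : Consistent X P astar T) (hI : CoverInvariant X P astar T S)
    (hL : ∃ d, (S.L d).Nonempty) {N : ℕ}
    (hN : (undone T S).card * (T.D.card * X.passCost) ≤ N) :
    RunInvariant X P astar (X.nextMetaAction T S) N := by
  unfold Input.nextMetaAction
  split_ifs with hC
  · have hi := X.sel.metaAction_mem S.C hC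
    set i := X.sel.metaAction S.C
    have hiD := hI.mem_D i (hI.nonempty_of_mem_C i hi)
    have hu : i ∈ undone T S := mem_undone.2 ⟨hiD, Or.inr hi⟩
    refine RunInvariant.startPass hS hT hI hi (le_trans ?_ hN)
    have h1 := Finset.card_erase_add_one hu
    have h2 : 0 < (S.E i).card := Finset.card_pos.2 ⟨i, hI.self_mem i⟩
    have h3 : 0 < T.D.card := Finset.card_pos.2 ⟨i, hiD⟩
    have h4 : (T.D.card - (S.E i).card) * X.passCost + X.passCost ≤ T.D.card * X.passCost := by
      rw [← Nat.succ_mul]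
      exact Nat.mul_le_mul_right _ (by omega)
    have h5 : (m + X.n + 1).choose m ≤ X.passCost := by unfold Input.passCost; omega
    unfold otherCalls
    rw [← h1, Nat.succ_mul]
    omega
  · exact ⟨hT, hI, isApproxOptimal_findContract hS hT hI (Finset.not_nonempty_iff_eq_empty.1 hC) hL⟩

theorem RunInvariant.endPass (hS : Setting X P astar) {T : Dictionary m} {S : Cover m}
    (hT : Consistent X P astar T) (hI : CoverInvariant X P astar T S) {i : ℕ} (hi : i ∈ S.C) {N : ℕ}
    (hN : otherCalls X T S i ≤ N)
    (hN' : ¬ S.U i ⊆ S.L i → (m + X.n + 1).choose m + (T.D.card - (S.E i).card) * X.passCost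
      + otherCalls X T S i ≤ N) :
    RunInvariant X P astar (X.endPass T S i) N := by
  unfold Input.endPass
  split_ifs with h
  · have hiL := hI.nonempty_of_mem_C i hi
    refine RunInvariant.nextMetaAction hS hT (hI.erase h) ⟨i, hiL⟩ (le_trans ?_ hN)
    refine Nat.mul_le_mul_right _ (Finset.card_le_card fun e he => ?_)
    obtain ⟨heD, he⟩ := mem_undone.1 he
    rw [Finset.mem_erase, mem_undone]
    rcases he with he | he
    · exact ⟨by rintro rfl; exact hiL.ne_empty he, heD, Or.inl he⟩
    · exact ⟨Finset.ne_of_mem_erase he, heD, Or.inr (Finset.mem_of_mem_erase he)⟩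
  · exact RunInvariant.startPass hS hT hI hi (hN' h)

theorem RunInvariant.search (hS : Setting X P astar) {T : Dictionary m} {S : Cover m}
    (hT : Consistent X P astar T) (hI : CoverInvariant X P astar T S) {i j k : ℕ} (hi : i ∈ S.C)
    (hj : j ∈ S.E i) (hk : k ∉ S.E i) (hkL : (S.L k).Nonempty) {p₁ p₂ : Contract m}
    (hp₁ : p₁ ∈ X.region) (hp₂ : p₂ ∈ X.region) (hj₁ : astar p₁ ∈ actionsOf X P astar T j)
    (hk₂ : astar p₂ ∈ actionsOf X P astar T k) {ℓ N : ℕ} (hℓ : dist₂ p₁ p₂ ≤ X.η * 2 ^ ℓ)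
    (hN : (m + X.n + 1).choose m + (T.D.card - (S.E i).card - 1) * X.passCost + otherCalls X T S i + ℓ
      ≤ N) :
    RunInvariant X P astar (X.search T S i p₁ p₂ j k) N := by
  unfold Input.search
  split_ifs with hd
  · exact ⟨hT, hI, hi, rfl, hp₁, hp₂, hj, hj₁, hk, hkL, hk₂, hd, ℓ, hℓ, hN⟩
  · have hE : ((X.cut T S i p₁ p₂ j k).E i).card = (S.E i).card + 1 := by
      change (Function.update S.E i (insert k (S.E i)) i).card = _
      rw [Function.update_self, Finset.card_insert_of_notMem hk]
    have ho : otherCalls X T (X.cut T S i p₁ p₂ j k) i = otherCalls X T S i := rfl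
    refine RunInvariant.endPass hS hT
      (hI.cut hS hT hi hj hk hkL hp₁ hp₂ hj₁ hk₂ (not_lt.1 hd)) hi ?_ fun _ => ?_
    · rw [ho]; omega
    · rw [ho, hE, Nat.sub_add_eq]; omega

theorem dist₂_le (hS : Setting X P astar) {p p' : Contract m} (hp : p ∈ X.region)
    (hp' : p' ∈ X.region) : dist₂ p p' ≤ X.η * 2 ^ X.searchSteps := by
  have h1 := hS.one_le_B
  have hη := hS.η_pos
  have hm := hS.one_le_m
  have hsq : ∀ p ∈ X.region, ∑ ω, p ω ^ 2 ≤ (m * X.B) ^ 2 := fun p hp => by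
    calc ∑ ω, p ω ^ 2 ≤ (∑ ω, p ω) ^ 2 := Finset.sum_sq_le_sq_sum_of_nonneg fun ω _ => hp.1 ω
      _ ≤ (m * X.B) ^ 2 := by
          refine pow_le_pow_left₀ (Finset.sum_nonneg fun ω _ => hp.1 ω) ?_ 2
          refine le_trans (le_of_eq ?_) hp.2
          exact Finset.sum_congr rfl fun ω _ => (abs_of_nonneg (hp.1 ω)).symm
  have h2 : dist₂ p p' ≤ 2 * X.B * m := by
    refine Real.sqrt_le_iff.2 ⟨by positivity, ?_⟩
    calc ∑ ω, (p ω - p' ω) ^ 2 ≤ ∑ ω, (p ω ^ 2 + p' ω ^ 2) := by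
          refine Finset.sum_le_sum fun ω _ => ?_
          nlinarith [mul_nonneg (hp.1 ω) (hp'.1 ω)]
      _ ≤ (m * X.B) ^ 2 + (m * X.B) ^ 2 := by
          rw [Finset.sum_add_distrib]
          exact add_le_add (hsq p hp) (hsq p' hp')
      _ ≤ (2 * X.B * m) ^ 2 := by nlinarith [sq_nonneg (m * X.B)]
  have h3 : 0 < 2 * X.B * m / X.η := by positivity
  have h4 : 2 * X.B * m / X.η ≤ 2 ^ X.searchSteps := by
    have := Nat.le_ceil (Real.logb 2 (2 * X.B * m / X.η))
    rw [Real.logb_le_iff_le_rpow one_lt_two h3, Real.rpow_natCast] at this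
    exact this
  rw [div_le_iff₀ hη] at h4
  linarith

theorem dist₂_mid_left (p p' : Contract m) : dist₂ (mid p p') p' = dist₂ p p' / 2 := by
  have : ∀ ω, (mid p p' ω - p' ω) ^ 2 = (1 / 2) ^ 2 * (p ω - p' ω) ^ 2 := fun ω => by
    simp only [mid]; ring
  unfold dist₂
  simp_rw [this]
  rw [← Finset.mul_sum, Real.sqrt_mul (by positivity), Real.sqrt_sq (by norm_num)]
  ring

theorem dist₂_mid_right (p p' : Contract m) : dist₂ p (mid p p') = dist₂ p p' / 2 := by
  have : ∀ ω, (p ω - mid p p' ω) ^ 2 = (1 / 2) ^ 2 * (p ω - p' ω) ^ 2 := fun ω => by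
    simp only [mid]; ring
  unfold dist₂
  simp_rw [this]
  rw [← Finset.mul_sum, Real.sqrt_mul (by positivity), Real.sqrt_sq (by norm_num)]
  ring

theorem RunInvariant.tryCover {T : Dictionary m} (hS : Setting X P astar)
    (hT : Consistent X P astar T) :
    RunInvariant X P astar (X.tryCover T) (1 + T.D.card * (T.D.card * X.passCost)) :=
  ⟨hT, CoverInvariant.tryCover T, X.sel.contract_mem _ ⟨0, zero_mem_region hS⟩, fun _ => rfl, le_rfl⟩

theorem RunInvariant.mono {s : Control m} {N : ℕ} (h : RunInvariant X P astar s N)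
    {T' : Dictionary m} (hT' : Consistent X P astar T') (hD : T'.D = s.T.D)
    (hrep : T'.rep = s.T.rep)
    (hA : ∀ e, actionsOf X P astar s.T e ⊆ actionsOf X P astar T' e) :
    RunInvariant X P astar { s with T := T' } N := by
  obtain ⟨T, S, phase, point⟩ := s
  obtain ⟨hT, hI, hph⟩ := h
  refine ⟨hT', hI.mono hD hrep hA, ?_⟩
  have ho : ∀ i, otherCalls X T' S i = otherCalls X T S i := fun i => by
    simp only [otherCalls, undone, hD]
  have hD' : T'.D = T.D := hD
  cases phase with
  | first => simpa only [PhaseInvariant, hD'] using hph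
  | vertex i V => simpa only [PhaseInvariant, hD', ho] using hph
  | left i p =>
    simp only [PhaseInvariant, hD', ho] at hph ⊢
    obtain ⟨h1, h2, h3, ⟨k, h4, h5, h6⟩, h7⟩ := hph
    exact ⟨h1, h2, h3, ⟨k, h4, h5, hA k h6⟩, h7⟩
  | right i j =>
    simp only [PhaseInvariant, hD', ho] at hph ⊢
    obtain ⟨h1, h2, h3, ⟨k, h4, h5, h6⟩, h7⟩ := hph
    exact ⟨h1, h2, h3, ⟨k, h4, h5, hA k h6⟩, h7⟩
  | middle i p₁ p₂ j k =>
    simp only [PhaseInvariant, hD', ho] at hph ⊢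
    obtain ⟨h1, h2, h3, h4, h5, h6, h7, h8, h9, h10⟩ := hph
    exact ⟨h1, h2, h3, h4, h5, hA j h6, h7, h8, hA k h9, h10⟩
  | halted => exact hph

theorem RunInvariant.point_mem {s : Control m} {N : ℕ} (h : RunInvariant X P astar s N)
    (hph : s.phase ≠ Phase.halted) : s.point ∈ X.region := by
  obtain ⟨T, S, phase, point⟩ := s
  obtain ⟨hT, hI, hp⟩ := h
  cases phase with
  | first => exact hp.1
  | vertex i V => exact hI.U_subset_region i hp.2.1.1
  | left i p =>
    obtain ⟨h1, h2, -⟩ := hp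
    dsimp only at h2 ⊢
    rw [h2]
    exact hI.seed_mem i (hI.nonempty_of_mem_C i h1)
  | right i j => exact hp.2.2.1
  | middle i p₁ p₂ j k =>
    obtain ⟨-, h0, h1, h2, -⟩ := hp
    dsimp only at h0 ⊢
    rw [h0]
    exact mid_mem_region h1 h2
  | halted => exact absurd rfl hph

theorem RunInvariant.one_le {s : Control m} {N : ℕ} (h : RunInvariant X P astar s N)
    (hph : s.phase ≠ Phase.halted) : 1 ≤ N := by
  obtain ⟨T, S, phase, point⟩ := s
  obtain ⟨hT, hI, hp⟩ := h
  have hQ : 2 ≤ X.passCost := by unfold Input.passCost; omega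
  have hcost : ∀ i k, i ∈ S.C → k ∉ S.E i → (S.L k).Nonempty →
      X.passCost ≤ (T.D.card - (S.E i).card) * X.passCost := fun i k hi hk hkL => by
    have := hI.card_E_lt hi hk hkL
    dsimp only at this
    exact Nat.le_mul_of_pos_left _ (by omega)
  cases phase with
  | first => have := hp.2.2; dsimp only at this; omega
  | vertex i V => have := hp.2.2.2.2; dsimp only at this; omega
  | left i p =>
    obtain ⟨h1, -, -, ⟨k, h2, h3, -⟩, h4⟩ := hp
    have := hcost i k h1 h2 h3
    dsimp only at h4
    omega
  | right i j =>
    obtain ⟨h1, -, -, ⟨k, h2, h3, -⟩, h4⟩ := hp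
    have := hcost i k h1 h2 h3
    dsimp only at h4
    omega
  | middle i p₁ p₂ j k =>
    obtain ⟨-, -, -, -, -, -, -, -, -, h1, ℓ, h2, h3⟩ := hp
    have : ℓ ≠ 0 := by
      rintro rfl
      rw [pow_zero, mul_one] at h2
      exact absurd h2 (not_le.2 h1)
    dsimp only at h3
    omega
  | halted => exact absurd rfl hph

open Classical in
/-- The invariant is preserved when `Action-Oracle` answers by the meta-action of the action that
has been played. -/
theorem RunInvariant.continueWith (hS : Setting X P astar) {T : Dictionary m} {S : Cover m}
    {phase : Phase m} {p : Contract m} {N d : ℕ}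
    (h : RunInvariant X P astar ⟨T, S, phase, p⟩ (N + 1)) (hph : phase ≠ Phase.halted)
    (hd : d ∈ T.D) (hpd : astar p ∈ actionsOf X P astar T d) :
    RunInvariant X P astar (X.continueWith T S phase p d) N := by
  have hp := h.point_mem hph
  obtain ⟨hT, hI, hphase⟩ := h
  dsimp only at hT hI hphase hp
  -- the answer at `p` is the meta-action of the action played under `p`
  have huniq : ∀ e, (S.L e).Nonempty → astar p ∈ actionsOf X P astar T e → d = e :=
    fun e he hpe => hT.eq_of_mem_actionsOf hd (hI.mem_D e he) hpd hpe
  have hI₁ := hI.discover hS hd hp hpd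
  set S₁ := Input.discover S d p with hS₁
  have hE₁ : S₁.E = S.E := discover_E S d p
  have hU₁ : S₁.U = S.U := discover_U S d p
  have hd₁ : (S₁.L d).Nonempty := discover_nonempty S d p
  have hu₁ : undone T S₁ = undone T S := undone_discover T S d p
  have ho₁ : ∀ i, otherCalls X T S₁ i = otherCalls X T S i := fun i => by
    simp only [otherCalls, hu₁]
  cases phase with
  | first =>
    obtain ⟨-, -, hN⟩ := hphase
    refine RunInvariant.nextMetaAction hS hT hI₁ ⟨d, hd₁⟩ ?_
    have := Nat.mul_le_mul_right (T.D.card * X.passCost) (card_undone_le T S₁)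
    omega
  | vertex i V =>
    obtain ⟨hi, hpe, hV, hcov, hN⟩ := hphase
    have hi₁ : i ∈ S₁.C := mem_discover_C hi
    have hiL := hI.nonempty_of_mem_C i hi
    have hiL₁ := hI₁.nonempty_of_mem_C i hi₁
    have hLi : S₁.L i = S.L i := (discover_L_of_nonempty hiL).1
    have hsub : X.continueWith T S (Phase.vertex i V) p d =
        if d ∈ S₁.E i then
          if V.Nonempty then
            X.nextVertex T
              { S₁ with L := Function.update S₁.L i (convexHull ℝ (S₁.L i ∪ {p})) } i V
          else X.endPass T
              { S₁ with L := Function.update S₁.L i (convexHull ℝ (S₁.L i ∪ {p})) } i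
        else { T := T, S := S₁, phase := Phase.left i p, point := S₁.seed i } := rfl
    rw [hsub]
    split_ifs with hdE hVne
    all_goals
      try set S₂ : Cover m :=
        { S₁ with L := Function.update S₁.L i (convexHull ℝ (S₁.L i ∪ {p})) } with hS₂
    · have hI₂ : CoverInvariant X P astar T S₂ :=
        hI₁.addPoint hS hT hiL₁ (by rw [hU₁]; exact hpe.1) hdE hpd
      have hL₂ : S₂.L i = convexHull ℝ (S.L i ∪ {p}) := by rw [hS₂, ← hLi]; simp
      have hu₂ : undone T S₂ = undone T S := by
        rw [← hu₁]
        ext e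
        rw [mem_undone, mem_undone]
        rcases eq_or_ne e i with rfl | hne
        · simp [hS₂, hi₁]
        · simp [hS₂, hne]
      refine RunInvariant.nextVertex hT hI₂ hi₁ ?_ hVne ?_ ?_
      · change V ⊆ (S₁.U i).extremePoints ℝ
        rw [hU₁]; exact hV
      · intro p' hp'
        change p' ∈ (S₁.U i).extremePoints ℝ at hp'
        rw [hU₁] at hp'
        rw [hL₂]
        rcases hcov p' hp' with rfl | h | h
        · exact Or.inr (subset_convexHull ℝ _ (Or.inr rfl))
        · exact Or.inl h
        · exact Or.inr (subset_convexHull ℝ _ (Or.inl h))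
      · have h1 : (S₂.E i) = S.E i := by rw [← hE₁]
        have h2 : otherCalls X T S₂ i = otherCalls X T S i := by simp only [otherCalls, hu₂]
        rw [h1, h2]
        omega
    · have hI₂ : CoverInvariant X P astar T S₂ :=
        hI₁.addPoint hS hT hiL₁ (by rw [hU₁]; exact hpe.1) hdE hpd
      have hL₂ : S₂.L i = convexHull ℝ (S.L i ∪ {p}) := by rw [hS₂, ← hLi]; simp
      have hu₂ : undone T S₂ = undone T S := by
        rw [← hu₁]
        ext e
        rw [mem_undone, mem_undone]
        rcases eq_or_ne e i with rfl | hne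
        · simp [hS₂, hi₁]
        · simp [hS₂, hne]
      refine RunInvariant.endPass hS hT hI₂ hi₁ ?_ fun hn => absurd ?_ hn
      · have h2 : otherCalls X T S₂ i = otherCalls X T S i := by simp only [otherCalls, hu₂]
        rw [h2]
        omega
      · refine hI₂.U_subset_L_of_extremePoints fun p' hp' => ?_
        change p' ∈ (S₁.U i).extremePoints ℝ at hp'
        rw [hU₁] at hp'
        rw [hL₂]
        rcases hcov p' hp' with rfl | h | h
        · exact subset_convexHull ℝ _ (Or.inr rfl)
        · exact absurd ⟨p', h⟩ hVne
        · exact subset_convexHull ℝ _ (Or.inl h)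
    · refine ⟨hT, hI₁, hi₁, rfl, hp, ⟨d, hdE, hd₁, hpd⟩, ?_⟩
      dsimp only
      rw [ho₁, hE₁]
      omega
  | left i p₂ =>
    obtain ⟨hi, rfl, hp₂, hk, hN⟩ := hphase
    have hiL := hI.nonempty_of_mem_C i hi
    obtain rfl := huniq i hiL (hI.seed_action i hiL)
    exact ⟨hT, hI, hi, rfl, hp₂, hk, hN⟩
  | right i j =>
    obtain ⟨hi, rfl, -, ⟨k, hk, hkL, hpk⟩, hN⟩ := hphase
    have hiL := hI.nonempty_of_mem_C j hi
    obtain rfl := huniq k hkL hpk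
    refine RunInvariant.search hS hT hI hi (hI.self_mem j) hk hkL (hI.seed_mem j hiL) hp
      (hI.seed_action j hiL) hpd (dist₂_le hS (hI.seed_mem j hiL) hp) ?_
    obtain ⟨f, hf⟩ := Nat.exists_eq_add_of_lt (hI.card_E_lt hi hk hkL)
    have h1 : T.D.card - (S.E j).card = f + 1 := by omega
    rw [h1, Nat.succ_mul] at hN
    rw [h1, Nat.add_sub_cancel]
    have h2 : X.passCost = (m + X.n + 1).choose m + 2 + X.searchSteps := rfl
    omega
  | middle i p₁ p₂ j k =>
    obtain ⟨hi, rfl, hp₁, hp₂, hj, hj₁, hk, hkL, hk₂, hηd, ℓ, hℓ, hN⟩ := hphase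
    have hi₁ : i ∈ S₁.C := mem_discover_C hi
    have hkL₁ : (S₁.L k).Nonempty := by
      rw [hS₁, (discover_L_of_nonempty hkL).1]; exact hkL
    have hℓ0 : ℓ ≠ 0 := by
      rintro rfl
      rw [pow_zero, mul_one] at hℓ
      exact absurd hℓ (not_le.2 hηd)
    obtain ⟨ℓ, rfl⟩ := Nat.exists_eq_succ_of_ne_zero hℓ0
    have hℓ' : dist₂ p₁ p₂ / 2 ≤ X.η * 2 ^ ℓ := by
      rw [Nat.succ_eq_add_one, pow_succ] at hℓ
      linarith
    have hN₁ : (m + X.n + 1).choose m + (T.D.card - (S₁.E i).card - 1) * X.passCost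
        + otherCalls X T S₁ i + ℓ ≤ N := by
      rw [hE₁, ho₁]; omega
    have hsub : X.continueWith T S (Phase.middle i p₁ p₂ j k) (mid p₁ p₂) d =
        if d ∈ S₁.E i then X.search T S₁ i (mid p₁ p₂) p₂ d k
        else X.search T S₁ i p₁ (mid p₁ p₂) j d := rfl
    rw [hsub]
    split_ifs with hdE
    · exact RunInvariant.search hS hT hI₁ hi₁ hdE (by rw [hE₁]; exact hk) hkL₁ hp hp₂ hpd hk₂
        (by rw [dist₂_mid_left]; exact hℓ') hN₁
    · exact RunInvariant.search hS hT hI₁ hi₁ (by rw [hE₁]; exact hj) hdE hd₁ hp₁ hp hj₁ hpd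
        (by rw [dist₂_mid_right]; exact hℓ') hN₁
  | halted => exact absurd rfl hph

/-- A bound on the number of calls of `Action-Oracle` in the runs of `Try-Cover` that may follow when
the progress is `t`: a run that starts with progress `s` works with at most `min s (2 * n - s)`
meta-actions. -/
def restartCalls (X : Input m) (t : ℕ) : ℕ :=
  ∑ s ∈ Finset.Ico (t + 1) (2 * X.n),
    (1 + min s (2 * X.n - s) * (min s (2 * X.n - s) * X.passCost))

theorem restartCalls_antitone (X : Input m) {t t' : ℕ} (h : t ≤ t') :
    restartCalls X t' ≤ restartCalls X t :=
  Finset.sum_le_sum_of_subset (Finset.Ico_subset_Ico (by omega) le_rfl)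

theorem add_restartCalls_le {T : Dictionary m} (hT : Consistent X P astar T) (hD : T.D.Nonempty)
    {t : ℕ} (ht : t < progress X P astar T) :
    1 + T.D.card * (T.D.card * X.passCost) + restartCalls X (progress X P astar T)
      ≤ restartCalls X t := by
  refine le_trans ?_ (restartCalls_antitone X (t' := progress X P astar T - 1) (by omega))
  have h1 := hT.card_le
  have h2 := card_discoveredActions_le (P := P) (astar := astar) T
  have h3 := Finset.card_pos.2 hD
  have hp : progress X P astar T = 2 * (discoveredActions X P astar T).card - T.D.card := rfl
  unfold restartCalls
  rw [Nat.sub_add_cancel (by omega),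
    Finset.sum_eq_sum_Ico_succ_bot (a := progress X P astar T) (b := 2 * X.n) (by omega)]
  have h4 : T.D.card ≤ min (progress X P astar T) (2 * X.n - progress X P astar T) := by
    rw [le_min_iff]; constructor <;> omega
  gcongr

/-- The calls of `Action-Oracle` that remain decrease with every call whose empirical distribution
is accurate. -/
theorem RunInvariant.answer (hS : Setting X P astar) {s : Control m} {N : ℕ}
    (h : RunInvariant X P astar s N) (hph : s.phase ≠ Phase.halted) {G : Fin m → ℝ}
    (hG : ‖G - P.F (astar s.point)‖ ≤ X.ε) :
    ∃ N', RunInvariant X P astar (X.answer s G) N' ∧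
      N' + restartCalls X (progress X P astar (X.answer s G).T) + 1
        ≤ N + restartCalls X (progress X P astar s.T) := by
  have hp := h.point_mem hph
  have h1 := h.one_le hph
  unfold Input.answer
  rcases hrec : s.T.record X.ε G with ⟨_ | d, T'⟩
  · obtain ⟨hT', hlt, hne⟩ := h.consistent.of_record_eq_none hp hG hrec
    refine ⟨_, RunInvariant.tryCover hS hT', ?_⟩
    have := add_restartCalls_le hT' hne hlt
    change 1 + T'.D.card * (T'.D.card * X.passCost) + restartCalls X (progress X P astar T') + 1 ≤ _
    omega
  · obtain ⟨hd, hT', hD, hrep, hA, hpd⟩ := h.consistent.of_record_eq_some hp hG hrec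
    obtain ⟨N, rfl⟩ := Nat.exists_eq_add_of_le' h1
    have hT : (X.continueWith T' s.S s.phase s.point d).T = T' := by
      have hnm : ∀ S, (X.nextMetaAction T' S).T = T' := fun S => by
        unfold Input.nextMetaAction; split_ifs <;> rfl
      have hep : ∀ S i, (X.endPass T' S i).T = T' := fun S i => by
        unfold Input.endPass
        split_ifs
        · exact hnm _
        · rfl
      have hse : ∀ S i p₁ p₂ j k, (X.search T' S i p₁ p₂ j k).T = T' := fun S i p₁ p₂ j k => by
        unfold Input.search
        split_ifs
        · rfl
        · exact hep _ _
      unfold Input.continueWith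
      cases s.phase with
      | first => exact hnm _
      | vertex i V =>
        dsimp only
        split_ifs
        · rfl
        · exact hep _ _
        · rfl
      | left i p => rfl
      | right i j => exact hse _ _ _ _ _ _
      | middle i p₁ p₂ j k =>
        dsimp only
        split_ifs
        · exact hse _ _ _ _ _ _
        · exact hse _ _ _ _ _ _
      | halted => rfl
    refine ⟨N, RunInvariant.continueWith hS (h.mono hT' hD hrep hA) hph (hD ▸ hd) hpd, ?_⟩
    dsimp only
    rw [hT]
    have := restartCalls_antitone X (progress_le_of_subset (X := X) (P := P) (astar := astar) hD hA)
    omega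

/-! ### The failure probability -/

/-- The argument of the logarithm in the definition of `α` is large, so that this logarithm dominates
the additive constants in the number of calls. -/
theorem Setting.le_div_η (hS : Setting X P astar) : 4096 ≤ 2 * X.B * m / X.η := by
  have h1 := hS.one_le_n
  have h2 := hS.one_le_m
  have h3 := hS.one_le_B
  have h4 := hS.ε_pos
  have h5 := hS.B_mul_ε
  have h6 := hS.ρ_mem
  have h7 := hS.η_pos
  have h8 : √(m : ℝ) ≤ m := Real.sqrt_le_iff.2 ⟨by positivity, by nlinarith⟩
  have h9 : X.ε * √(m : ℝ) * X.n ≤ X.B * X.ε * m * (X.n : ℝ) ^ 2 := by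
    calc X.ε * √(m : ℝ) * X.n ≤ X.ε * m * X.n := by gcongr
      _ ≤ X.B * (X.ε * m * X.n) := le_mul_of_one_le_left (by positivity) h3
      _ ≤ X.B * (X.ε * m * X.n) * X.n := le_mul_of_one_le_right (by positivity) h1
      _ = _ := by ring
  have h10 : X.ρ ^ 2 ≤ 1 := by nlinarith [h6.1, h6.2]
  have h11 : 1 ≤ X.B * m := by nlinarith
  rw [le_div_iff₀ h7]
  have : X.η = X.ε * √(m : ℝ) * X.n / 2 := rfl
  linarith

theorem Setting.four_le_log (hS : Setting X P astar) : 4 ≤ Real.log (2 * X.B * m / X.η) := by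
  have h1 := hS.le_div_η
  have h2 : Real.log 4096 = 12 * Real.log 2 := by
    rw [← Real.log_rpow two_pos]; norm_num
  have h3 := Real.log_two_gt_d9
  have h4 := Real.log_le_log (by norm_num) h1
  linarith

theorem Setting.three_le_choose (hS : Setting X P astar) : 3 ≤ (m + X.n + 1).choose m := by
  have h1 := hS.n_pos
  have h2 := hS.m_pos
  have h3 : (m + 2).choose m ≤ (m + X.n + 1).choose m := Nat.choose_le_choose m (by omega)
  have h4 : (m + 2).choose m = (m + 2).choose 2 := Nat.choose_symm_add
  have h5 : (1 + 2).choose 2 ≤ (m + 2).choose 2 := Nat.choose_le_choose 2 (by omega)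
  have h6 : (1 + 2).choose 2 = 3 := by decide
  omega

theorem sum_min_sq_le (n : ℕ) :
    ∑ s ∈ Finset.range (2 * n), min s (2 * n - s) * min s (2 * n - s) ≤ n ^ 3 := by
  rw [two_mul, Finset.sum_range_add, ← Finset.sum_add_distrib]
  calc ∑ s ∈ Finset.range n, (min s (n + n - s) * min s (n + n - s)
        + min (n + s) (n + n - (n + s)) * min (n + s) (n + n - (n + s)))
      ≤ ∑ _s ∈ Finset.range n, n ^ 2 := by
        refine Finset.sum_le_sum fun s hs => ?_
        obtain ⟨t, rfl⟩ := Nat.exists_eq_add_of_lt (Finset.mem_range.1 hs)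
        rw [min_eq_left (by omega), min_eq_right (by omega),
          show s + t + 1 + (s + t + 1) - (s + t + 1 + s) = t + 1 by omega]
        nlinarith
    _ = n ^ 3 := by simp; ring

/-- The number of calls of `Action-Oracle` that is assumed in the definition of `α` is sufficient. -/
theorem Setting.restartCalls_add_one_le (hS : Setting X P astar) :
    ((restartCalls X 0 + 1 : ℕ) : ℝ) ≤ 2 * (X.n : ℝ) ^ 3 *
      (Real.log (2 * X.B * m / X.η) + ((m + X.n + 1).choose m : ℝ)) := by
  have hn := hS.n_pos
  have h1 : restartCalls X 0 + 1 ≤ X.n ^ 3 * (X.passCost + 2) := by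
    have e1 : restartCalls X 0 ≤ (2 * X.n - 1) + X.n ^ 3 * X.passCost := by
      unfold restartCalls
      rw [Finset.sum_add_distrib]
      refine add_le_add (by simp) ?_
      simp_rw [← mul_assoc]
      rw [← Finset.sum_mul]
      refine Nat.mul_le_mul_right _ ((Finset.sum_le_sum_of_subset fun s hs => ?_).trans
        (sum_min_sq_le X.n))
      rw [Finset.mem_range]
      exact (Finset.mem_Ico.1 hs).2
    have e2 : X.n ≤ X.n ^ 3 := Nat.le_self_pow (by norm_num) _
    rw [mul_add]
    omega
  have h2 : ((restartCalls X 0 + 1 : ℕ) : ℝ) ≤ (X.n : ℝ) ^ 3 * (X.passCost + 2) := by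
    exact_mod_cast h1
  have hL := hS.four_le_log
  have hC : (3 : ℝ) ≤ ((m + X.n + 1).choose m : ℝ) := by exact_mod_cast hS.three_le_choose
  have h3 : (X.searchSteps : ℝ) ≤ 1.4428 * Real.log (2 * X.B * m / X.η) + 1 := by
    have hpos : 0 ≤ Real.logb 2 (2 * X.B * m / X.η) :=
      div_nonneg (by linarith) (Real.log_nonneg one_le_two)
    refine (Nat.ceil_lt_add_one hpos).le.trans ?_
    have hl2 := Real.log_two_gt_d9
    have : Real.logb 2 (2 * X.B * m / X.η) ≤ 1.4428 * Real.log (2 * X.B * m / X.η) := by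
      rw [Real.logb, div_le_iff₀ (by linarith)]
      nlinarith
    linarith
  have h4 : (X.passCost : ℝ) = ((m + X.n + 1).choose m : ℝ) + 2 + X.searchSteps := by
    unfold Input.passCost
    push_cast
    ring
  have h5 : (0 : ℝ) ≤ (X.n : ℝ) ^ 3 := by positivity
  refine h2.trans ?_
  rw [mul_comm (2 : ℝ), mul_assoc]
  refine mul_le_mul_of_nonneg_left ?_ h5
  rw [h4]
  linarith

theorem Setting.α_pos (hS : Setting X P astar) : 0 < X.α := by
  have h1 := hS.one_le_n
  have h2 := hS.four_le_log
  have h3 := hS.δ_mem.1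
  unfold Input.α
  positivity

theorem Setting.restartCalls_mul_α_le (hS : Setting X P astar) :
    (restartCalls X 0 + 1 : ℝ) * X.α ≤ X.δ := by
  have h1 := hS.one_le_n
  have h2 := hS.four_le_log
  have h3 := hS.δ_mem.1
  have h4 := hS.restartCalls_add_one_le
  push_cast at h4
  have h5 : 0 < 2 * (X.n : ℝ) ^ 3 *
      (Real.log (2 * X.B * m / X.η) + ((m + X.n + 1).choose m : ℝ)) := by positivity
  calc (restartCalls X 0 + 1 : ℝ) * X.α ≤ (2 * (X.n : ℝ) ^ 3 *
      (Real.log (2 * X.B * m / X.η) + ((m + X.n + 1).choose m : ℝ))) * X.α :=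
        mul_le_mul_of_nonneg_right h4 hS.α_pos.le
    _ = X.δ := mul_div_cancel₀ _ h5.ne'

theorem Setting.α_lt_one (hS : Setting X P astar) : X.α < 1 := by
  have h1 := hS.restartCalls_mul_α_le
  have h2 := hS.α_pos
  have h3 := hS.δ_mem.2
  have h4 : (0 : ℝ) ≤ restartCalls X 0 * X.α := by positivity
  linarith

theorem Setting.log_pos (hS : Setting X P astar) : 0 < Real.log (2 * m / X.α) := by
  have h1 := hS.one_le_m
  refine Real.log_pos ?_
  rw [lt_div_iff₀ hS.α_pos]
  linarith [hS.α_lt_one]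

theorem Setting.q_pos (hS : Setting X P astar) : 0 < X.q := by
  have h1 := hS.ε_pos
  have h2 := hS.log_pos
  exact Nat.ceil_pos.2 (by positivity)

/-- The probability that one call of `Action-Oracle` computes an inaccurate distribution is at most
`α`. -/
theorem Setting.deviationBound_le_α (hS : Setting X P astar) (f : Fin m → ℝ) :
    deviationBound X.q X.ε f [] ≤ X.α := by
  have h1 := hS.one_le_m
  have h2 := hS.α_pos
  have h3 := hS.ε_pos
  refine (deviationBound_nil_le X.q f).trans ?_
  have h4 : 1 / (2 * X.ε ^ 2) * Real.log (2 * m / X.α) ≤ X.q := Nat.le_ceil _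
  have h5 : Real.log (2 * m / X.α) ≤ 2 * X.ε ^ 2 * X.q := by
    have := mul_le_mul_of_nonneg_left h4 (show 0 ≤ 2 * X.ε ^ 2 by positivity)
    rwa [← mul_assoc, mul_one_div_cancel (by positivity), one_mul] at this
  have h6 : Real.exp (-(2 * X.ε ^ 2 * X.q)) ≤ X.α / (2 * m) := by
    calc Real.exp (-(2 * X.ε ^ 2 * X.q)) ≤ Real.exp (-Real.log (2 * m / X.α)) :=
          Real.exp_le_exp.2 (neg_le_neg h5)
      _ = X.α / (2 * m) := by rw [Real.exp_neg, Real.exp_log (by positivity), inv_div]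
  calc 2 * m * Real.exp (-(2 * X.ε ^ 2 * X.q)) ≤ 2 * m * (X.α / (2 * m)) :=
        mul_le_mul_of_nonneg_left h6 (by positivity)
    _ = X.α := mul_div_cancel₀ _ (by positivity)

theorem le_outcomeLaw_bind {β : Type*} (a : Fin X.n) (f : Fin m → PMF β) (A : Set β) (x : Fin m → ℝ)
    (h : ∀ ω, ENNReal.ofReal (x ω) ≤ (f ω).toOuterMeasure A) :
    ENNReal.ofReal (∑ ω, P.F a ω * x ω) ≤ ((P.outcomeLaw a).bind f).toOuterMeasure A := by
  rw [PMF.toOuterMeasure_bind_apply, tsum_fintype]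
  calc ENNReal.ofReal (∑ ω, P.F a ω * x ω) ≤ ∑ ω, ENNReal.ofReal (P.F a ω * x ω) :=
        Finset.le_sum_of_subadditive ENNReal.ofReal ENNReal.ofReal_zero.le
          (fun _ _ => ENNReal.ofReal_add_le) _ _
    _ ≤ ∑ ω, P.outcomeLaw a ω * (f ω).toOuterMeasure A := by
        refine Finset.sum_le_sum fun ω _ => ?_
        rw [ENNReal.ofReal_mul (P.F_nonneg a ω)]
        exact mul_le_mul_right (h ω) _

/-- The runs that have terminated and returned a `ρ`-optimal contract. -/
def goodResults (X : Input m) (P : PrincipalAgent X.n m) (astar : Contract m → Fin X.n) :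
    Set (Option (Contract m)) :=
  {x | ∃ p : Contract m, x = some p ∧ P.IsApproxOptimal astar X.B X.ρ p}

theorem resultLaw_of_halted {s : Control m} {N : ℕ} (h : RunInvariant X P astar s N)
    (hph : s.phase = Phase.halted) (l : List (Fin m)) (R : ℕ) :
    (P.resultLaw astar X.algorithm R (s, l)).toOuterMeasure (goodResults X P astar) = 1 := by
  have hmove : X.algorithm.move (s, l) = Move.output s.point := by
    simp [Input.algorithm, hph]
  have hgood : P.IsApproxOptimal astar X.B X.ρ s.point := by
    have := h.phase
    rwa [hph] at this
  have hlaw : P.resultLaw astar X.algorithm R (s, l) = PMF.pure (some s.point) := by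
    cases R <;> simp only [PrincipalAgent.resultLaw, hmove]
  rw [hlaw, PMF.toOuterMeasure_pure_apply, if_pos ⟨s.point, rfl, hgood⟩]

/-- The union bound over the calls of `Action-Oracle`: if `l` has been observed in the current call
and at most `K` further calls follow, then `q * (K + 1) - l.length` rounds suffice, up to a failure
probability of `α` for each of these calls and of `deviationBound` for the current one. -/
theorem le_resultLaw (hS : Setting X P astar) (R : ℕ) : ∀ (s : Control m) (l : List (Fin m))
    (N K : ℕ), RunInvariant X P astar s N → s.phase ≠ Phase.halted →
    N + restartCalls X (progress X P astar s.T) ≤ K + 1 → l.length < X.q →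
    X.q * (K + 1) ≤ R + l.length →
    ENNReal.ofReal (1 - K * X.α - deviationBound X.q X.ε (P.F (astar s.point)) l)
      ≤ (P.resultLaw astar X.algorithm R (s, l)).toOuterMeasure (goodResults X P astar) := by
  induction R with
  | zero =>
    intro s l N K _ _ _ hl hR
    have := Nat.le_mul_of_pos_right X.q (Nat.succ_pos K)
    rw [Nat.succ_eq_add_one] at this
    omega
  | succ R ih =>
    intro s l N K hI hph hNK hl hR
    have hmove : X.algorithm.move (s, l) = Move.commit s.point := by
      obtain ⟨T, S, phase, point⟩ := s
      cases phase <;> first | rfl | exact absurd rfl hph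
    have hlaw : P.resultLaw astar X.algorithm (R + 1) (s, l) =
        (P.outcomeLaw (astar s.point)).bind fun ω =>
          P.resultLaw astar X.algorithm R (X.algorithm.observe (s, l) ω) := by
      simp only [PrincipalAgent.resultLaw, hmove]
    set f := P.F (astar s.point) with hf
    rw [hlaw]
    refine le_trans (ENNReal.ofReal_le_ofReal ?_) (le_outcomeLaw_bind (astar s.point) _ _
      (fun ω => 1 - K * X.α - deviationBound X.q X.ε f (ω :: l)) fun ω => ?_)
    · have h1 := sum_deviationBound_cons_le X.q X.ε f (P.F_nonneg _) (P.F_sum _) l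
      simp only [mul_sub (P.F _ _), Finset.sum_sub_distrib, ← Finset.sum_mul, P.F_sum]
      linarith
    · by_cases hlen : l.length + 1 < X.q
      · have hobs : X.algorithm.observe (s, l) ω = (s, ω :: l) := if_pos hlen
        rw [hobs]
        exact ih s (ω :: l) N K hI hph hNK (by simpa using hlen) (by rw [List.length_cons]; omega)
      · have hobs : X.algorithm.observe (s, l) ω = (X.answer s (empirical (ω :: l)), []) :=
          if_neg hlen
        have hlq : (ω :: l).length = X.q := by rw [List.length_cons]; omega
        rw [hobs]
        have hdev := deviationBound_nonneg X.q X.ε f (ω :: l)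
        have hα := hS.α_pos
        by_cases hG : ‖empirical (ω :: l) - f‖ ≤ X.ε
        · obtain ⟨N', hI', hN'⟩ := hI.answer hS hph hG
          by_cases hph' : (X.answer s (empirical (ω :: l))).phase = Phase.halted
          · rw [resultLaw_of_halted hI' hph', ENNReal.ofReal_le_one]
            have : 0 ≤ K * X.α := by positivity
            linarith
          · have h1 := hI'.one_le hph'
            obtain ⟨K, rfl⟩ : ∃ K', K = K' + 1 := ⟨K - 1, by omega⟩
            rw [Nat.mul_succ] at hR
            rw [List.length_cons] at hlq
            refine le_trans (ENNReal.ofReal_le_ofReal ?_)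
              (ih _ [] N' K hI' hph' (by omega) hS.q_pos (by rw [List.length_nil]; omega))
            have := hS.deviationBound_le_α
              (P.F (astar (X.answer s (empirical (ω :: l))).point))
            push_cast
            linarith
        · have h1 := one_le_deviationBound hS.q_pos hS.ε_pos f (ω :: l) hlq hG
          rw [ENNReal.ofReal_eq_zero.2]
          · exact zero_le
          · have : 0 ≤ K * X.α := by positivity
            linarith

theorem progress_empty : progress X P astar (Dictionary.empty m) = 0 := by
  simp [progress, discoveredActions, Dictionary.empty]

theorem le_resultLaw_start (hS : Setting X P astar) :
    ENNReal.ofReal (1 - X.δ) ≤ (P.resultLaw astar X.algorithm (X.q * (restartCalls X 0 + 1))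
      X.algorithm.start).toOuterMeasure (goodResults X P astar) := by
  have hI : RunInvariant X P astar (X.tryCover (Dictionary.empty m)) 1 :=
    by simpa [Dictionary.empty] using RunInvariant.tryCover hS consistent_empty
  have hprog : progress X P astar (X.tryCover (Dictionary.empty m)).T = 0 := progress_empty
  refine le_trans (ENNReal.ofReal_le_ofReal ?_) (le_resultLaw hS _ _ [] 1 (restartCalls X 0) hI
    (by simp [Input.tryCover]) (by rw [hprog]; omega) hS.q_pos le_rfl)
  have h1 := hS.deviationBound_le_α
    (P.F (astar (X.tryCover (Dictionary.empty m)).point))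
  have h2 := hS.restartCalls_mul_α_le
  linarith

/-! ### The number of rounds -/

theorem choose_le_mul_pow {m : ℕ} (hm : 0 < m) (n : ℕ) :
    (m + n + 1).choose m ≤ (m + 1) * (n + 1) * m ^ n := by
  have hsymm : ∀ n, (m + n + 1).choose m = (m + n + 1).choose (n + 1) := fun n => by
    rw [add_assoc]; exact Nat.choose_symm_add
  rcases Nat.lt_or_ge m 2 with h | h
  · obtain rfl : m = 1 := by omega
    simp
    omega
  · have key : (m + n + 1).choose m ≤ (m + 1) * m ^ n := by
      induction n with
      | zero => simp
      | succ n ih =>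
        rw [hsymm] at ih ⊢
        have h1 := Nat.add_one_mul_choose_eq (m + n + 1) (n + 1)
        rw [show m + (n + 1) + 1 = m + n + 1 + 1 by ring]
        refine Nat.le_of_mul_le_mul_right (c := n + 1 + 1) ?_ (Nat.succ_pos _)
        rw [← h1]
        have h2 : m + n + 1 + 1 ≤ m * (n + 1 + 1) := by nlinarith
        calc (m + n + 1 + 1) * (m + n + 1).choose (n + 1)
            ≤ (m * (n + 1 + 1)) * ((m + 1) * m ^ n) := Nat.mul_le_mul h2 ih
          _ = _ := by ring
    calc _ ≤ (m + 1) * m ^ n := key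
      _ ≤ (m + 1) * (n + 1) * m ^ n := by
        refine Nat.mul_le_mul_right _ (Nat.le_mul_of_pos_right _ (Nat.succ_pos n))

/-- The polynomial factor of the bound on the number of calls of `Action-Oracle`. -/
def callsPolynomial : MvPolynomial (Fin 3) ℝ :=
  8192 * MvPolynomial.X 2 ^ 2 * MvPolynomial.X 0 ^ 3 * MvPolynomial.X 1
    + (MvPolynomial.X 0 + 1) * (MvPolynomial.X 1 + 1)

/-- The polynomial factor of the bound on the number of rounds. -/
def roundsPolynomial : MvPolynomial (Fin 3) ℝ :=
  (2 ^ 19 * MvPolynomial.X 2 ^ 2 * MvPolynomial.X 0 ^ 4 * MvPolynomial.X 1 ^ 4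
      * (4 * MvPolynomial.X 0 * MvPolynomial.X 1 ^ 3 + MvPolynomial.X 1 * MvPolynomial.X 0
        + callsPolynomial + 2) + 1)
    * (2 * MvPolynomial.X 1 ^ 3 * callsPolynomial)

theorem Setting.rounds_le (hS : Setting X P astar) :
    ((X.q * (restartCalls X 0 + 1) : ℕ) : ℝ) ≤
      (m : ℝ) ^ X.n * MvPolynomial.eval ![(m : ℝ), (X.n : ℝ), X.B] roundsPolynomial
        * (1 / X.ρ ^ 4) * (1 + Real.log (1 / X.δ)) * (1 + Real.log (1 / X.ρ)) ^ 2 := by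
  have hn := hS.one_le_n
  have hm := hS.one_le_m
  have hB := hS.one_le_B
  have hε := hS.ε_pos
  have hη := hS.η_pos
  obtain ⟨hρ0, hρ1⟩ := hS.ρ_mem
  obtain ⟨hδ0, hδ1⟩ := hS.δ_mem
  have hlogρ : 0 ≤ Real.log (1 / X.ρ) := Real.log_nonneg (by rw [le_div_iff₀ hρ0]; linarith)
  have hlogδ : 0 ≤ Real.log (1 / X.δ) := Real.log_nonneg (by rw [le_div_iff₀ hδ0]; linarith)
  set lρ := 1 + Real.log (1 / X.ρ) with hlρ
  set lδ := 1 + Real.log (1 / X.δ) with hlδ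
  clear_value lρ lδ
  have hlρ1 : 1 ≤ lρ := by linarith
  have hlδ1 : 1 ≤ lδ := by linarith
  set a : ℝ := 8192 * X.B ^ 2 * m ^ 3 * X.n + (m + 1) * (X.n + 1) with ha
  have ha1 : 1 ≤ a := by
    have : 0 ≤ 8192 * X.B ^ 2 * (m : ℝ) ^ 3 * X.n := by positivity
    nlinarith
  have heval : MvPolynomial.eval ![(m : ℝ), (X.n : ℝ), X.B] roundsPolynomial =
      (2 ^ 19 * X.B ^ 2 * m ^ 4 * X.n ^ 4 * (4 * m * X.n ^ 3 + X.n * m + a + 2) + 1)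
        * (2 * X.n ^ 3 * a) := by
    simp [roundsPolynomial, callsPolynomial, ha]
  clear_value a
  have ha0 : 0 < a := by linarith
  have hlρ0 : 0 < lρ := by linarith
  set L := Real.log (2 * X.B * m / X.η) with hL
  set C := ((m + X.n + 1).choose m : ℝ) with hC
  have hL4 : 4 ≤ L := hS.four_le_log
  have hmn : 1 ≤ (m : ℝ) ^ X.n := one_le_pow₀ hm
  have hLle : L ≤ 8192 * X.B ^ 2 * m ^ 3 * X.n * lρ := by
    have h1 : 2 * X.B * m / X.η ≤ 4096 * X.B ^ 2 * m ^ 3 * X.n * (1 / X.ρ) ^ 2 := by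
      have hs1 : 1 ≤ √(m : ℝ) := Real.one_le_sqrt.2 hm
      rw [div_le_iff₀ hη]
      have : 4096 * X.B ^ 2 * m ^ 3 * X.n * (1 / X.ρ) ^ 2 * X.η = 2 * X.B * m * √(m : ℝ) := by
        unfold Input.η Input.ε
        field_simp
        ring
      rw [this]
      exact le_mul_of_one_le_right (by positivity) hs1
    have h2 : L ≤ Real.log (4096 * X.B ^ 2 * m ^ 3 * X.n) + 2 * Real.log (1 / X.ρ) := by
      have := Real.log_le_log (by positivity) h1
      rwa [Real.log_mul (by positivity) (by positivity), Real.log_pow] at this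
    have h3 := Real.log_le_self (show 0 ≤ 4096 * X.B ^ 2 * (m : ℝ) ^ 3 * X.n by positivity)
    have h4 : 1 ≤ X.B ^ 2 * (m : ℝ) ^ 3 * X.n :=
      one_le_mul_of_one_le_of_one_le
        (one_le_mul_of_one_le_of_one_le (one_le_pow₀ hB) (one_le_pow₀ hm)) hn
    nlinarith [mul_nonneg (sub_nonneg.2 h4) hlogρ]
  have hCle : C ≤ (m + 1) * (X.n + 1) * m ^ X.n := by
    rw [hC]
    exact_mod_cast choose_le_mul_pow hS.m_pos X.n
  have hA : L + C ≤ m ^ X.n * a * lρ := by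
    have h1 : 8192 * X.B ^ 2 * m ^ 3 * X.n * lρ ≤ m ^ X.n * (8192 * X.B ^ 2 * m ^ 3 * X.n * lρ) :=
      le_mul_of_one_le_left (by positivity) hmn
    have h2 : (m + 1) * (X.n + 1) * (m : ℝ) ^ X.n ≤ (m + 1) * (X.n + 1) * m ^ X.n * lρ :=
      le_mul_of_one_le_right (by positivity) hlρ1
    calc L + C ≤ m ^ X.n * (8192 * X.B ^ 2 * m ^ 3 * X.n * lρ)
          + (m + 1) * (X.n + 1) * m ^ X.n * lρ := by linarith
      _ = _ := by rw [ha]; ring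
  have hC0 : 0 ≤ C := Nat.cast_nonneg _
  have hA0 : 0 < L + C := by linarith
  have hcalls : ((restartCalls X 0 + 1 : ℕ) : ℝ) ≤ 2 * X.n ^ 3 * (m ^ X.n * a * lρ) :=
    hS.restartCalls_add_one_le.trans (mul_le_mul_of_nonneg_left hA (by positivity))
  -- the logarithm in `q`
  have hlog : Real.log (2 * m / X.α) ≤ (4 * m * X.n ^ 3 + X.n * m + a + 2) * (lδ * lρ) := by
    have e1 : 2 * m / X.α = (1 / X.δ) * (4 * m * X.n ^ 3 * (L + C)) := by
      unfold Input.α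
      rw [← hL, ← hC]
      field_simp
      ring
    have h1 : Real.log (4 * m * X.n ^ 3 * (L + C))
        ≤ Real.log (4 * m * X.n ^ 3) + (X.n * Real.log m + Real.log a + Real.log lρ) := by
      rw [Real.log_mul (by positivity) hA0.ne']
      have := Real.log_le_log hA0 hA
      rw [Real.log_mul (by positivity) (by positivity), Real.log_mul (by positivity) (by positivity),
        Real.log_pow] at this
      linarith
    have h2 := Real.log_le_self (show 0 ≤ 4 * (m : ℝ) * X.n ^ 3 by positivity)
    have h3 := mul_le_mul_of_nonneg_left (Real.log_le_self (show 0 ≤ (m : ℝ) by positivity))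
      (show (0 : ℝ) ≤ X.n by positivity)
    have h4 := Real.log_le_self (show 0 ≤ a by linarith)
    have h5 := Real.log_le_self (show 0 ≤ lρ by linarith)
    rw [e1, Real.log_mul (by positivity) (mul_pos (by positivity) hA0).ne']
    set b : ℝ := 4 * m * X.n ^ 3 + X.n * m + a with hb
    have hb0 : 0 ≤ b := by positivity
    have h6 : Real.log (1 / X.δ) + Real.log (4 * m * X.n ^ 3 * (L + C)) ≤ lδ + (b + lρ) := by
      linarith
    have h7 : 1 ≤ lδ * lρ := one_le_mul_of_one_le_of_one_le hlδ1 hlρ1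
    have h8 : lδ ≤ lδ * lρ := le_mul_of_one_le_right (by linarith) hlρ1
    have h9 : lρ ≤ lδ * lρ := le_mul_of_one_le_left (by linarith) hlδ1
    have h10 := mul_le_mul_of_nonneg_left h7 hb0
    linarith
  set b : ℝ := 4 * m * X.n ^ 3 + X.n * m + a + 2
  have hb0 : 0 ≤ b := by positivity
  clear_value b
  have hρ4 : 1 ≤ 1 / X.ρ ^ 4 := by
    rw [le_div_iff₀ (by positivity), one_mul]
    exact pow_le_one₀ hρ0.le hρ1.le
  have hq : (X.q : ℝ) ≤ (2 ^ 19 * X.B ^ 2 * m ^ 4 * X.n ^ 4 * b + 1) * (1 / X.ρ ^ 4)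
      * (lδ * lρ) := by
    have h1 : (X.q : ℝ) ≤ 1 / (2 * X.ε ^ 2) * Real.log (2 * m / X.α) + 1 :=
      (Nat.ceil_lt_add_one (mul_nonneg (by positivity) hS.log_pos.le)).le
    have h2 : 1 / (2 * X.ε ^ 2) = 2 ^ 19 * X.B ^ 2 * m ^ 4 * X.n ^ 4 * (1 / X.ρ ^ 4) := by
      unfold Input.ε
      field_simp
      norm_num
    have h3 : 1 ≤ (1 / X.ρ ^ 4) * (lδ * lρ) :=
      one_le_mul_of_one_le_of_one_le hρ4 (one_le_mul_of_one_le_of_one_le hlδ1 hlρ1)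
    rw [h2] at h1
    have h4 := mul_le_mul_of_nonneg_left hlog
      (show 0 ≤ 2 ^ 19 * X.B ^ 2 * (m : ℝ) ^ 4 * X.n ^ 4 * (1 / X.ρ ^ 4) by positivity)
    calc (X.q : ℝ) ≤ 2 ^ 19 * X.B ^ 2 * m ^ 4 * X.n ^ 4 * (1 / X.ρ ^ 4) * (b * (lδ * lρ))
          + (1 / X.ρ ^ 4) * (lδ * lρ) := by linarith
      _ = _ := by ring
  rw [heval, Nat.cast_mul]
  refine (mul_le_mul hq hcalls (Nat.cast_nonneg _) (by positivity)).trans (le_of_eq ?_)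
  ring

end

end DiscoverAndCover

end

theorem theorem2 :
    ∃ (poly : MvPolynomial (Fin 3) ℝ) (k : ℕ),
      ∀ (n m : ℕ) (P : PrincipalAgent n m) (astar : Contract m → Fin n),
        P.IsAgentResponse astar →
      ∀ (sel : DiscoverAndCover.SelectionRule m) (B ρ δ : ℝ),
        1 ≤ B → ρ ∈ Set.Ioo (0 : ℝ) 1 → δ ∈ Set.Ioo (0 : ℝ) 1 →
      ∃ N : ℕ,
        (N : ℝ) ≤ (m : ℝ) ^ n * MvPolynomial.eval ![(m : ℝ), (n : ℝ), B] poly * (1 / ρ ^ 4) *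
          (1 + Real.log (1 / δ)) * (1 + Real.log (1 / ρ)) ^ k ∧
        ENNReal.ofReal (1 - δ) ≤
          (P.resultLaw astar
            (DiscoverAndCover.Input.algorithm ⟨n, P.r, B, ρ, δ, sel⟩) N
            (DiscoverAndCover.Input.algorithm ⟨n, P.r, B, ρ, δ, sel⟩).start).toOuterMeasure
            {x | ∃ p : Contract m, x = some p ∧ P.IsApproxOptimal astar B ρ p} := by
  refine ⟨DiscoverAndCover.roundsPolynomial, 2, fun n m P astar hres sel B ρ δ hB hρ hδ => ?_⟩
  let X : DiscoverAndCover.Input m := ⟨n, P.r, B, ρ, δ, sel⟩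
  have hS : DiscoverAndCover.Setting X P astar := ⟨hres, rfl, hB, hρ, hδ⟩
  exact ⟨X.q * (DiscoverAndCover.restartCalls X 0 + 1), hS.rounds_le,
    DiscoverAndCover.le_resultLaw_start hS⟩
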